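/- **Setting.** Let $\mathcal X$ be a metric space with its Borel $\sigma$-algebra and let $\rho$ be a probability measure on $\mathcal X\times\mathbb R$, the law of $(X,Y)$, whose marginal $\rho_X$ on $\mathcal X$ is carried by a separable subset of $\mathcal X$ (automatic if $\mathcal X$ is separable). Consider the regression model $Y=f^*(X)+\epsilon$ with $\mathbf E(\epsilon\mid X)=0$, where $f^*:\mathcal X\to\mathbb R$ is measurable and the noise $\epsilon$ has a conditional density $p_{\epsilon|X}(t|x)$, jointly measurable in $(x,t)$, given $X=x$. For measurable $f:\mathcal X\to\mathbb R$ let $p_E$ be the probability density of the error $E=Y-f(X)$, let $$\mathscr R(f)=-\log\int_{\mathbb R}(p_E(e))^2\,de$$ be its Rényi entropy of order $2$, and let $\mathscr R^*=\inf_f\mathscr R(f)$, the infimum being over all measurable $f:\mathcal X\to\mathbb R$. The model is *MEE admissible*: $p_{\epsilon|X}$ is bounded by a constant $M_p$ uniformly in $x$ and $t$; $f^*$ is bounded; and the minimum of $\mathscr R$ over measurable functions is achieved. The hypothesis space $\mathcal H$ is a set of continuous functions on $\mathcal X$ and is *MEE admissible*: (1) there is $M$ with $|f(x)|\le M$ for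 all $f\in\mathcal H$, $x\in\mathcal X$; (2) there are $c>0$ and $0<s<2$ such that $\mathcal N_2(\mathcal H,\varepsilon)<\infty$ and $\log\mathcal N_2(\mathcal H,\varepsilon)\le c\,\varepsilon^{-s}$ for all $\varepsilon>0$; (3) $\mathcal H$ contains $f^*$ and a minimizer of $\mathscr R$. Here $\mathcal N_2(\mathcal H,\varepsilon)$ is the supremum, over all $n\ge1$ and $(x_1,\dots,x_n)\in\mathcal X^n$, of the minimal number of balls in $\mathbb R^n$ of radius $\varepsilon$, for the metric $d_2(a,b)=\big(\frac1n\sum_{i=1}^n|a_i-b_i|^2\big)^{1/2}$, that cover $\{(f(x_i))_{i=1}^n: f\in\mathcal H\}$. Let $\mathbf z=\{(x_i,y_i)\}_{i=1}^n$ be an i.i.d. sample from $\rho$, let $h=h(n)>0$ be a bandwidth, $G_h(t)=\frac1{\sqrt{2\pi}h}e^{-t^2/(2h^2)}$, and let $f_{\mathbf z}\in\mathcal H$ be (for almost every sample) a minimizer over $\mathcal H$ of $$\mathscr R_{\mathbf z}(f)=-\log\Big(\frac1{n^2}\sum_{i,j=1}^nG_h(e_i-e_j)\Big),\qquad e_i=y_i-f(x_i).$$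 **Theorem.** 1. If $\lim_{n\to\infty}h(n)=0$ and $\lim_{n\to\infty}h(n)^2\sqrt n=+\infty$, then $\mathscr R(f_{\mathbf z})$ converges to $\mathscr R^*$ in probability: for every $\varepsilon>0$, $\lim_{n\to\infty}\mathbf P\big(\mathscr R(f_{\mathbf z})-\mathscr R^*>\varepsilon\big)=0$. 2. Suppose in addition to admissibility that $t\mapsto p_{\epsilon|X}(t|x)$ is differentiable for every $x$, with derivative bounded by a constant $M'$ independent of $x$ and $t$. Then for all constants $0<C_1\le C_2$ there is a constant $C>0$, depending only on $\rho$, $f^*$, $p_{\epsilon|X}$, $\mathcal H$, $C_1$ and $C_2$, such that, whenever $C_1n^{-1/6}\le h(n)\le C_2n^{-1/6}$ for all $n\ge1$, one has for every $n\ge1$ and every $0<\delta<1$, with probability at least $1-\delta$, $$\mathscr R(f_{\mathbf z})-\mathscr R^*\le C\sqrt{\log(2/\delta)}\;n^{-1/6}.$$ (If an event above is not known to be measurable, the claims are made for the outer probability of the exceptional event.) -/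

import Mathlib

open MeasureTheory Filter Topology

namespace MEE

noncomputable section

variable {𝒳 : Type*}

/-- The Gaussian kernel `G_h(t) = (√(2π) h)⁻¹ exp(-t² / (2h²))`. -/
def gaussKernel (h t : ℝ) : ℝ :=
  1 / (Real.sqrt (2 * Real.pi) * h) * Real.exp (-(t ^ 2) / (2 * h ^ 2))

/-- The error `y - f(x)` of `f` at the observation `z = (x, y)`. -/
def err (f : 𝒳 → ℝ) (z : 𝒳 × ℝ) : ℝ := z.2 - f z.1

/-- The probability density function of the error variable `E = Y - f(X)`, where
`(X, Y)` has law `ρ`. -/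
def errorDensity [MeasurableSpace 𝒳] (ρ : Measure (𝒳 × ℝ)) (f : 𝒳 → ℝ) (e : ℝ) : ℝ :=
  (pdf (err f) ρ volume e).toReal

/-- Rényi's error entropy of order two, `R(f) = -log ∫ p_E(e)² de`. -/
def renyiEntropy [MeasurableSpace 𝒳] (ρ : Measure (𝒳 × ℝ)) (f : 𝒳 → ℝ) : ℝ :=
  -Real.log (∫ e : ℝ, (errorDensity ρ f e) ^ 2)

/-- The minimal error entropy `R* = inf R(f)` over all measurable functions `f`. -/
def minRenyiEntropy [MeasurableSpace 𝒳] (ρ : Measure (𝒳 × ℝ)) : ℝ :=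
  sInf (renyiEntropy ρ '' {f : 𝒳 → ℝ | Measurable f})

/-- `f` is a measurable function at which the minimum of `R` over all measurable functions
is achieved. -/
def IsEntropyMinimizer [MeasurableSpace 𝒳] (ρ : Measure (𝒳 × ℝ)) (f : 𝒳 → ℝ) : Prop :=
  Measurable f ∧ ∀ g : 𝒳 → ℝ, Measurable g → renyiEntropy ρ f ≤ renyiEntropy ρ g

/-- The kernel density estimator `p_{E,z}(e) = (1/n) ∑ⱼ G_h(e - e_j)`, `e_j = y_j - f(x_j)`. -/
def kernelDensity {n : ℕ} (h : ℝ) (z : Fin n → 𝒳 × ℝ) (f : 𝒳 → ℝ) (e : ℝ) : ℝ :=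
  1 / (n : ℝ) * ∑ j, gaussKernel h (e - err f (z j))

/-- The empirical entropy `R_z(f) = -log ((1/n) ∑ᵢ p_{E,z}(e_i))`. -/
def empiricalEntropy {n : ℕ} (h : ℝ) (z : Fin n → 𝒳 × ℝ) (f : 𝒳 → ℝ) : ℝ :=
  -Real.log (1 / (n : ℝ) * ∑ i, kernelDensity h z f (err f (z i)))

/-- The regression model `Y = f*(X) + ε`, `E(ε | X) = 0`, where `(X, Y)` has law `ρ` and
`p x` is the density of the noise `ε` given `X = x`. -/
structure IsRegressionModel [MeasurableSpace 𝒳] (ρ : Measure (𝒳 × ℝ)) (fstar : 𝒳 → ℝ)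
    (p : 𝒳 → ℝ → ℝ) : Prop where
  measurable_fstar : Measurable fstar
  measurable_density : Measurable (Function.uncurry p)
  density_nonneg : ∀ x t, 0 ≤ p x t
  lintegral_density : ∀ x, ∫⁻ t, ENNReal.ofReal (p x t) = 1
  /-- The law of `(X, ε)`, `ε = Y - f*(X)`, is `p x t dρ_X(x) dt`. -/
  law_noise : ρ.map (fun z => (z.1, err fstar z)) =
    (ρ.fst.prod volume).withDensity (fun q => ENNReal.ofReal (p q.1 q.2))
  noise_mean : ∀ᵐ x ∂ρ.fst, Integrable (fun t => t * p x t) ∧ ∫ t, t * p x t = 0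

/-- MEE admissible regression models. -/
structure IsAdmissibleModel [MeasurableSpace 𝒳] (ρ : Measure (𝒳 × ℝ)) (fstar : 𝒳 → ℝ)
    (p : 𝒳 → ℝ → ℝ) : Prop extends IsRegressionModel ρ fstar p where
  density_bounded : ∃ Mp : ℝ, ∀ x t, p x t ≤ Mp
  fstar_bounded : ∃ M : ℝ, 0 < M ∧ ∀ x, |fstar x| ≤ M
  exists_minimizer : ∃ f, IsEntropyMinimizer ρ f

/-- The normalized `ℓ₂`-metric `d₂(a, b) = ((1/n) ∑ |a_i - b_i|²)^{1/2}` on `ℝⁿ`. -/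
def d2 {n : ℕ} (a b : Fin n → ℝ) : ℝ :=
  Real.sqrt (1 / (n : ℝ) * ∑ i, |a i - b i| ^ 2)

/-- The covering number of `S` by balls of radius `ε` of a pseudo-metric `d`: the least number
of balls whose union covers `S` (`⊤` if no finite number suffices). -/
def coveringNumber {α : Type*} (S : Set α) (ε : ℝ) (d : α → α → ℝ) : ℕ∞ :=
  ⨅ (T : Finset α) (_ : ∀ a ∈ S, ∃ b ∈ T, d a b < ε), (T.card : ℕ∞)

/-- The `ℓ₂`-norm empirical covering number: the supremum, over all finite samples
`x = (x_1, …, x_n)` of points, of the covering number of `{(f(x_i))_i : f ∈ H}` for `d₂`. -/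
def empiricalCoveringNumber (H : Set (𝒳 → ℝ)) (ε : ℝ) : ℕ∞ :=
  ⨆ (n : ℕ) (_ : 0 < n) (x : Fin n → 𝒳),
    coveringNumber ((fun (f : 𝒳 → ℝ) (i : Fin n) => f (x i)) '' H) ε d2

/-- MEE admissible hypothesis spaces (sets of continuous functions). -/
structure IsAdmissibleSpace [TopologicalSpace 𝒳] [MeasurableSpace 𝒳] (ρ : Measure (𝒳 × ℝ))
    (fstar : 𝒳 → ℝ) (H : Set (𝒳 → ℝ)) : Prop where
  continuous : ∀ f ∈ H, Continuous f
  bounded : ∃ M : ℝ, ∀ f ∈ H, ∀ x, |f x| ≤ M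
  entropy_bound : ∃ c s : ℝ, 0 < c ∧ 0 < s ∧ s < 2 ∧ ∀ ε : ℝ, 0 < ε →
    empiricalCoveringNumber H ε ≠ ⊤ ∧
      Real.log ((empiricalCoveringNumber H ε).toNat : ℝ) ≤ c * ε ^ (-s)
  minimizer_mem : ∃ f ∈ H, IsEntropyMinimizer ρ f
  fstar_mem : fstar ∈ H

/-- The law of a sample of `n` independent observations, each with law `ρ`. -/
def sampleLaw [MeasurableSpace 𝒳] (ρ : Measure (𝒳 × ℝ)) (n : ℕ) : Measure (Fin n → 𝒳 × ℝ) :=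
  Measure.pi (fun _ => ρ)

/-- `fz` is an empirical MEE algorithm over `H` with bandwidths `h(n)`: for almost every sample
`z` of size `n`, `fz n z` minimizes the empirical entropy `R_z` over `H`. -/
def IsEmpiricalMEE [MeasurableSpace 𝒳] (ρ : Measure (𝒳 × ℝ)) (H : Set (𝒳 → ℝ)) (h : ℕ → ℝ)
    (fz : (n : ℕ) → (Fin n → 𝒳 × ℝ) → 𝒳 → ℝ) : Prop :=
  ∀ n : ℕ, 0 < n → ∀ᵐ z ∂(sampleLaw ρ n),
    fz n z ∈ H ∧ ∀ f ∈ H, empiricalEntropy (h n) z (fz n z) ≤ empiricalEntropy (h n) z f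

end

end MEE

/-! Write `V(f) = ∫ p_E²`, so the entropy is `-log V`, and minimizing the empirical entropy means
maximizing `pairMean`, the double average of `G_h(eᵢ - eⱼ)`. Up to diagonal terms of order `1/(nh)`,
its expectation is the smoothed potential `S_h(f) = ∫ G_h(u) A(u) du`, with `A` the autocorrelation
of the error density.

The bias is one-sided. As `A` is largest at `0`, where it equals `V(f)`, one has `S_h(f) ≤ V(f)` for
every `f` (`smoothedPotential_le`). Comparing the empirical minimizer with an entropy minimizer `g`
in `H` therefore requires a bias bound at the single function `g` only: it tends to zero by
continuity of translations in `L¹`, and is at most `M' h` for a Lipschitz density. A uniform lower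
bound for `V` on `H` (`exists_pos_le_integral_sq`) turns potential gaps into entropy gaps.

What remains is the deviation of `pairMean` from its expectation, uniformly over `H`
(`sampleLaw_exists_mem_le`). McDiarmid's inequality reduces it to the mean of the supremum.
Symmetrization with random swaps between two samples applies directly to the double sum; for fixed
pairs, the increments are functions of independent coins with bounded differences. The responses
cancel in these increments, so they are sub-Gaussian for the `d2` metric at the `2n` inputs, with
scale `L/√n` and `L = h⁻²` the Lipschitz constant of the kernel. Dudley chaining with entropy
exponent `s < 2` gives a bound of order `1/(h²√n)`. With `h ~ n^(-1/6)` this balances the bias `h`.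
-/

namespace MEE

open ProbabilityTheory
open scoped NNReal

/-! ### Bounded differences and sub-Gaussian concentration -/

/-- The integral over `Fin (n + 1) → Z` of a product measure, computed by integrating the first
coordinate last. -/
theorem integral_pi_succ {Z : Type*} [MeasurableSpace Z] (μ : Measure Z) [IsProbabilityMeasure μ]
    {n : ℕ} (F : (Fin (n + 1) → Z) → ℝ)
    (hF : Integrable F (Measure.pi fun _ : Fin (n + 1) => μ)) :
    ∫ z, F z ∂(Measure.pi fun _ : Fin (n + 1) => μ) =
      ∫ a, ∫ z, F (Fin.cons a z) ∂(Measure.pi fun _ : Fin n => μ) ∂μ := by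
  have hmp := (measurePreserving_piFinSuccAbove (fun _ : Fin (n + 1) => μ) 0).symm
  have hF' := (hmp.integrable_comp_emb (MeasurableEquiv.measurableEmbedding _)).2 hF
  rw [← hmp.integral_comp']
  refine (integral_prod _ hF').trans ?_
  refine integral_congr_ae (Eventually.of_forall fun a => integral_congr_ae
    (Eventually.of_forall fun z => ?_))
  exact congrArg F (Fin.insertNth_zero' a z)

theorem integrable_of_abs_le {Ω : Type*} [MeasurableSpace Ω] {ν : Measure Ω} [IsFiniteMeasure ν]
    {F : Ω → ℝ} (hF : Measurable F) {B : ℝ} (hB : ∀ ω, |F ω| ≤ B) : Integrable F ν :=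
  Integrable.of_bound hF.aestronglyMeasurable B (Eventually.of_forall hB)

theorem integrable_exp_mul_of_abs_le {Ω : Type*} [MeasurableSpace Ω] {ν : Measure Ω}
    [IsFiniteMeasure ν] {F : Ω → ℝ} (hF : Measurable F) {B : ℝ} (hB : ∀ ω, |F ω| ≤ B) (t : ℝ) :
    Integrable (fun ω => Real.exp (t * F ω)) ν := by
  refine integrable_of_abs_le (B := Real.exp (|t| * B)) (by fun_prop) fun ω => ?_
  rw [abs_of_pos (Real.exp_pos _)]
  refine Real.exp_le_exp.2 ((le_abs_self _).trans ?_)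
  rw [abs_mul]
  exact mul_le_mul_of_nonneg_left (hB ω) (abs_nonneg t)

/-- A bounded random variable with oscillation at most `c` is sub-Gaussian. -/
theorem hasSubgaussianMGF_of_abs_sub_le {Ω : Type*} [MeasurableSpace Ω] {ν : Measure Ω}
    [IsProbabilityMeasure ν] {F : Ω → ℝ} (hF : Measurable F) {c : ℝ≥0}
    (hc : ∀ ω ω', |F ω - F ω'| ≤ c) :
    HasSubgaussianMGF (fun ω => F ω - ∫ ω', F ω' ∂ν) ((c / 2) ^ 2) ν := by
  have hne : Nonempty Ω := nonempty_of_isProbabilityMeasure ν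
  obtain ⟨ω₀⟩ := hne
  have hbdd : BddBelow (Set.range F) := by
    refine ⟨F ω₀ - c, ?_⟩
    rintro _ ⟨ω, rfl⟩
    linarith [(abs_le.1 (hc ω₀ ω)).2]
  have h := hasSubgaussianMGF_of_mem_Icc (μ := ν) (X := F) (a := ⨅ ω, F ω) (b := (⨅ ω, F ω) + c)
    hF.aemeasurable (Eventually.of_forall fun ω => ⟨ciInf_le hbdd ω, ?_⟩)
  · simpa using h
  · have : Nonempty Ω := ⟨ω₀⟩
    have : F ω - c ≤ ⨅ ω, F ω := le_ciInf fun ω' => by linarith [(abs_le.1 (hc ω ω')).2]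
    linarith

/-- **McDiarmid's bounded differences inequality**, in moment generating function form. -/
theorem hasSubgaussianMGF_of_boundedDifferences {Z : Type*} [MeasurableSpace Z] (μ : Measure Z)
    [IsProbabilityMeasure μ] {n : ℕ} {g : (Fin n → Z) → ℝ} (hg : Measurable g) {B : ℝ}
    (hB : ∀ z, |g z| ≤ B) {c : Fin n → ℝ≥0}
    (hc : ∀ z i w, |g (Function.update z i w) - g z| ≤ c i) :
    HasSubgaussianMGF (fun z => g z - ∫ z', g z' ∂(Measure.pi fun _ => μ)) (∑ i, (c i / 2) ^ 2)
      (Measure.pi fun _ => μ) := by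
  induction n generalizing B with
  | zero =>
    have h0 : (fun z => g z - ∫ z', g z' ∂(Measure.pi fun _ : Fin 0 => μ)) = fun _ => 0 := by
      funext z
      have : g = fun _ => g z := funext fun z' => congrArg g (Subsingleton.elim _ _)
      rw [this]
      simp
    rw [h0]
    simp
  | succ n ih =>
    set P := Measure.pi fun _ : Fin n => μ with hP
    set Q := Measure.pi fun _ : Fin (n + 1) => μ with hQ
    have hcons : Measurable fun q : Z × (Fin n → Z) => (Fin.cons q.1 q.2 : Fin (n + 1) → Z) := by
      refine measurable_pi_iff.2 (Fin.cases ?_ fun i => ?_)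
      · simpa using measurable_fst
      · simpa using (measurable_pi_apply (X := fun _ => Z) i).fun_comp measurable_snd
    have hgc : Measurable fun q : Z × (Fin n → Z) => g (Fin.cons q.1 q.2) := hg.comp hcons
    have hga : ∀ a, Measurable fun z : Fin n → Z => g (Fin.cons a z) := fun a =>
      hgc.comp measurable_prodMk_left
    -- The conditional mean given the first coordinate. It oscillates by at most `c 0`, which
    -- Hoeffding's lemma handles; conditionally on that coordinate, the remainder falls under the
    -- induction hypothesis, and the two exponential bounds multiply.
    set m : Z → ℝ := fun a => ∫ z, g (Fin.cons a z) ∂P with hm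
    have hmm : Measurable m :=
      (hgc.stronglyMeasurable.integral_prod_right (ν := P)).measurable
    have hmB : ∀ a, |m a| ≤ B := fun a => by
      simpa using norm_integral_le_of_norm_le_const (μ := P) (C := B)
        (f := fun z => g (Fin.cons a z)) (Eventually.of_forall fun z => hB _)
    have hint : Integrable g Q := integrable_of_abs_le hg hB
    have hmean : ∫ z, g z ∂Q = ∫ a, m a ∂μ := integral_pi_succ μ g hint
    have hosc : ∀ a a', |m a - m a'| ≤ c 0 := fun a a' => by
      rw [hm, ← integral_sub (integrable_of_abs_le (hga a) fun _ => hB _)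
        (integrable_of_abs_le (hga a') fun _ => hB _)]
      have h1 : ∀ z, ‖g (Fin.cons a z) - g (Fin.cons a' z)‖ ≤ c 0 := fun z => by
        have := hc (Fin.cons a' z) 0 a
        rwa [Fin.update_cons_zero] at this
      simpa using norm_integral_le_of_norm_le_const (μ := P) (Eventually.of_forall h1)
    have hout := hasSubgaussianMGF_of_abs_sub_le (ν := μ) hmm hosc
    have hin : ∀ a, HasSubgaussianMGF (fun z => g (Fin.cons a z) - m a)
        (∑ i : Fin n, (c i.succ / 2) ^ 2) P := fun a =>
      ih (hga a) (fun _ => hB _) fun z i w => by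
        have := hc (Fin.cons a z) i.succ w
        rwa [← Fin.cons_update] at this
    have hgB : ∀ z, |g z - ∫ z', g z' ∂Q| ≤ B + |∫ z', g z' ∂Q| := fun z =>
      (abs_sub _ _).trans (by gcongr; exact hB z)
    have hexp : ∀ t, Integrable (fun z => Real.exp (t * (g z - ∫ z', g z' ∂Q))) Q := fun t =>
      integrable_exp_mul_of_abs_le (hg.sub_const _) hgB t
    refine ⟨hexp, fun t => ?_⟩
    rw [mgf, integral_pi_succ μ _ (hexp t), Fin.sum_univ_succ, hmean]
    have key : ∀ a, ∫ z, Real.exp (t * (g (Fin.cons a z) - ∫ a, m a ∂μ)) ∂P ≤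
        Real.exp (t * (m a - ∫ a, m a ∂μ)) *
          Real.exp ((∑ i : Fin n, (c i.succ / 2) ^ 2 : ℝ≥0) * t ^ 2 / 2) := fun a => by
      have h1 : ∀ z, Real.exp (t * (g (Fin.cons a z) - ∫ a, m a ∂μ)) =
          Real.exp (t * (m a - ∫ a, m a ∂μ)) * Real.exp (t * (g (Fin.cons a z) - m a)) :=
        fun z => by rw [← Real.exp_add]; ring_nf
      simp_rw [h1, integral_const_mul]
      exact mul_le_mul_of_nonneg_left ((hin a).mgf_le t) (Real.exp_pos _).le
    have hnn : 0 ≤ᵐ[μ] fun a => ∫ z, Real.exp (t * (g (Fin.cons a z) - ∫ a, m a ∂μ)) ∂P :=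
      Eventually.of_forall fun a => integral_nonneg fun z => (Real.exp_pos _).le
    refine (integral_mono_of_nonneg hnn ((hout.integrable_exp_mul t).mul_const _)
      (Eventually.of_forall key)).trans ?_
    rw [integral_mul_const]
    refine (mul_le_mul_of_nonneg_right (hout.mgf_le t) (Real.exp_pos _).le).trans_eq ?_
    rw [← Real.exp_add]
    push_cast
    ring_nf

/-! ### Maximal inequality and chaining -/

section Chaining

variable {Ω ι : Type*} [MeasurableSpace Ω] [Finite Ω] [MeasurableSingletonClass Ω]
  {ν : Measure Ω} [IsProbabilityMeasure ν]

/-- The maximal inequality for finitely many sub-Gaussian variables. -/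
theorem integral_sup'_le_of_mgf_le (A : Finset ι) (hA : A.Nonempty) (X : ι → Ω → ℝ) {v l : ℝ}
    (hl : 0 < l) (hX : ∀ a ∈ A, ∫ ω, Real.exp (l * X a ω) ∂ν ≤ Real.exp (v * l ^ 2 / 2)) :
    ∫ ω, A.sup' hA (fun a => X a ω) ∂ν ≤ Real.log A.card / l + v * l / 2 := by
  have hcard : (0 : ℝ) < A.card := by exact_mod_cast hA.card_pos
  have hjensen : Real.exp (∫ ω, l * A.sup' hA (fun a => X a ω) ∂ν) ≤
      ∫ ω, Real.exp (l * A.sup' hA (fun a => X a ω)) ∂ν :=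
    convexOn_exp.map_integral_le Real.continuous_exp.continuousOn isClosed_univ
      (Eventually.of_forall fun _ => Set.mem_univ _) Integrable.of_finite Integrable.of_finite
  have hsum : ∫ ω, Real.exp (l * A.sup' hA (fun a => X a ω)) ∂ν ≤
      A.card * Real.exp (v * l ^ 2 / 2) := by
    calc _ ≤ ∫ ω, ∑ a ∈ A, Real.exp (l * X a ω) ∂ν := by
          refine integral_mono Integrable.of_finite Integrable.of_finite fun ω => ?_
          obtain ⟨a, ha, hmax⟩ := A.exists_mem_eq_sup' hA (fun a => X a ω)
          simp only [hmax]
          exact Finset.single_le_sum (f := fun a => Real.exp (l * X a ω))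
            (fun _ _ => (Real.exp_pos _).le) ha
      _ = ∑ a ∈ A, ∫ ω, Real.exp (l * X a ω) ∂ν :=
          integral_finsetSum _ fun _ _ => Integrable.of_finite
      _ ≤ ∑ _a ∈ A, Real.exp (v * l ^ 2 / 2) := Finset.sum_le_sum hX
      _ = _ := by simp
  have h := hjensen.trans hsum
  rw [integral_const_mul, ← Real.exp_log hcard, ← Real.exp_add, Real.exp_le_exp] at h
  have : ∫ ω, A.sup' hA (fun a => X a ω) ∂ν ≤ (Real.log A.card + v * l ^ 2 / 2) / l := by
    rw [le_div_iff₀ hl]; linarith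
  refine this.trans_eq ?_
  field_simp

/-- One step of chaining: passing from a finite index set `A` to a net `B` of `A`. -/
theorem integral_sup'_le_net (A B : Finset ι) (hA : A.Nonempty) (hB : B.Nonempty) (T : ι → Ω → ℝ)
    {v l : ℝ} (hl : 0 < l) (hT : ∀ a ∈ A, ∃ b ∈ B,
      ∫ ω, Real.exp (l * (T a ω - T b ω)) ∂ν ≤ Real.exp (v * l ^ 2 / 2)) :
    ∫ ω, A.sup' hA (fun a => T a ω) ∂ν ≤
      ∫ ω, B.sup' hB (fun a => T a ω) ∂ν + (Real.log A.card / l + v * l / 2) := by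
  classical
  -- `T a` is `T (π a)` plus an increment indexed by `a` alone, so the cost is `log A.card`,
  -- whatever the size of `B`.
  choose! π hπ hexp using hT
  refine le_trans ?_ (add_le_add_right
    (integral_sup'_le_of_mgf_le (ν := ν) A hA (fun a ω => T a ω - T (π a) ω) hl hexp) _)
  rw [← integral_add Integrable.of_finite Integrable.of_finite]
  refine integral_mono Integrable.of_finite Integrable.of_finite fun ω => ?_
  refine Finset.sup'_le _ _ fun a ha => ?_
  have h1 := Finset.le_sup' (fun a => T a ω) (hπ a ha)
  have h2 := Finset.le_sup' (fun a => T a ω - T (π a) ω) ha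
  simp only at h1 h2 ⊢
  linarith

/-- The constant in the chaining bound: for entropy numbers `c ε ^ (-s)` and radius `D`. -/
noncomputable def chainingConst (c s D : ℝ) : ℝ :=
  (c + 8) * D ^ (1 - s / 2) * (1 - (1 / 2 : ℝ) ^ (1 - s / 2))⁻¹

/-- **Dudley's chaining bound** for a centred sub-Gaussian process indexed by a finite set whose
entropy numbers are at most `c ε ^ (-s)`, `s < 2`. -/
theorem integral_sup'_le_chainingConst (F : Finset ι) (hF : F.Nonempty) (T : ι → Ω → ℝ)
    (d : ι → ι → ℝ) {σ c s D : ℝ} (hσ : 0 < σ) (hc : 0 ≤ c) (hs2 : s < 2)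
    (hD : 0 < D) (hmean : ∀ f ∈ F, ∫ ω, T f ω ∂ν = 0) (hd : ∀ f ∈ F, ∀ g ∈ F, 0 ≤ d f g)
    (hT : ∀ f ∈ F, ∀ g ∈ F, ∀ l : ℝ,
      ∫ ω, Real.exp (l * (T f ω - T g ω)) ∂ν ≤ Real.exp ((σ * d f g) ^ 2 * l ^ 2 / 2))
    (hdiam : ∀ f ∈ F, ∀ g ∈ F, d f g ≤ 2 * D)
    (hnet : ∀ ε : ℝ, 0 < ε → ∃ A ⊆ F, Real.log A.card ≤ c * ε ^ (-s) ∧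
      ∀ f ∈ F, ∃ a ∈ A, d f a ≤ 2 * ε) :
    ∫ ω, F.sup' hF (fun f => T f ω) ∂ν ≤ σ * chainingConst c s D := by
  set α : ℝ := 1 - s / 2 with hα
  have hα0 : 0 < α := by rw [hα]; linarith
  set q : ℝ := (1 / 2 : ℝ) ^ α with hq
  have hq0 : 0 ≤ q := by positivity
  have hq1 : q < 1 := Real.rpow_lt_one (by norm_num) (by norm_num) hα0
  -- Dyadic radii; the net at level `k` is `2 e k`-fine, since moving centres inside the class
  -- doubles the radius.
  set e : ℕ → ℝ := fun k => D * (1 / 2) ^ k with he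
  have he0 : ∀ k, 0 < e k := fun k => by positivity
  have hstep : ∀ (A B : Finset ι) (hA : A.Nonempty) (hB : B.Nonempty), A ⊆ F → B ⊆ F →
      ∀ r l : ℝ, 0 ≤ r → 0 < l → (∀ a ∈ A, ∃ b ∈ B, d a b ≤ r) →
      ∫ ω, A.sup' hA (fun a => T a ω) ∂ν ≤ ∫ ω, B.sup' hB (fun a => T a ω) ∂ν +
        (Real.log A.card / l + (σ * r) ^ 2 * l / 2) := by
    intro A B hA hB hAF hBF r l hr hl hAB
    refine integral_sup'_le_net A B hA hB T hl fun a ha => ?_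
    obtain ⟨b, hb, hab⟩ := hAB a ha
    refine ⟨b, hb, (hT a (hAF ha) b (hBF hb) l).trans (Real.exp_le_exp.2 ?_)⟩
    have := hd a (hAF ha) b (hBF hb)
    gcongr
  have hepow : ∀ k, e k ^ α = D ^ α * q ^ k := fun k => by
    rw [he, Real.mul_rpow hD.le (by positivity), ← Real.rpow_natCast, ← Real.rpow_mul (by norm_num),
      mul_comm (k : ℝ), Real.rpow_mul (by norm_num), Real.rpow_natCast]
  have hchain : ∀ k : ℕ, ∃ (A : Finset ι) (hA : A.Nonempty), A ⊆ F ∧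
      (∀ f ∈ F, ∃ a ∈ A, d f a ≤ 2 * e k) ∧
      ∫ ω, A.sup' hA (fun f => T f ω) ∂ν ≤
        σ * ((c + 8) * D ^ α * ∑ j ∈ Finset.range k, q ^ (j + 1)) := by
    intro k
    induction k with
    | zero =>
      obtain ⟨f₀, hf₀⟩ := hF
      refine ⟨{f₀}, Finset.singleton_nonempty _, by simpa using hf₀, fun f hf => ⟨f₀, by simp, ?_⟩, ?_⟩
      · simpa [he] using hdiam f hf f₀ hf₀
      · simp [hmean f₀ hf₀]
    | succ k ih =>
      obtain ⟨B, hB, hBF, hBnet, hBint⟩ := ih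
      obtain ⟨A, hAF, hAcard, hAnet⟩ := hnet (e (k + 1)) (he0 _)
      have hA : A.Nonempty := by
        obtain ⟨f₀, hf₀⟩ := hF
        obtain ⟨a, ha, -⟩ := hAnet f₀ hf₀
        exact ⟨a, ha⟩
      refine ⟨A, hA, hAF, hAnet, ?_⟩
      have hx := he0 (k + 1)
      set x := e (k + 1) with hxdef
      have hek : e k = 2 * x := by simp only [hxdef, he, pow_succ]; ring
      -- Passing to the coarser net costs distance `2 e k = 4x`. This `l` makes both `log A.card /
      -- l` and `(σ · 4x)² l / 2` of order `σ x^(1 - s/2)`, with factors `c` and `8`: hence the `c +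
      -- 8` in the constant. Summability over levels needs `s < 2`.
      have h := hstep A B hA hB hAF hBF (4 * x) (x ^ (-1 - s / 2) / σ) (by positivity)
        (by positivity) fun a ha => by
          obtain ⟨b, hb, hab⟩ := hBnet a (hAF ha)
          exact ⟨b, hb, hab.trans_eq (by rw [hek]; ring)⟩
      refine h.trans ?_
      have h1 : Real.log A.card / (x ^ (-1 - s / 2) / σ) ≤ σ * c * x ^ α := by
        calc Real.log A.card / (x ^ (-1 - s / 2) / σ)
            ≤ c * x ^ (-s) / (x ^ (-1 - s / 2) / σ) := by gcongr
          _ = σ * c * (x ^ (-s) / x ^ (-1 - s / 2)) := by field_simp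
          _ = σ * c * x ^ α := by rw [← Real.rpow_sub hx, hα]; ring_nf
      have h2 : (σ * (4 * x)) ^ 2 * (x ^ (-1 - s / 2) / σ) / 2 = σ * 8 * x ^ α := by
        have : x ^ α = x ^ (2 : ℕ) * x ^ (-1 - s / 2) := by
          rw [← Real.rpow_natCast, ← Real.rpow_add hx, hα]; push_cast; ring_nf
        rw [this]; field_simp; ring
      rw [h2, Finset.sum_range_succ]
      have h3 := hepow (k + 1)
      rw [← hxdef] at h3
      rw [h3] at h1 ⊢
      nlinarith [hBint, h1]
  have hsum : ∀ k, ∑ j ∈ Finset.range k, q ^ (j + 1) ≤ (1 - q)⁻¹ := fun k => by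
    calc _ ≤ ∑ j ∈ Finset.range k, q ^ j :=
          Finset.sum_le_sum fun j _ => pow_le_pow_of_le_one hq0 hq1.le (Nat.le_succ j)
      _ ≤ ∑' j, q ^ j := (summable_geometric_of_lt_one hq0 hq1).sum_le_tsum _ fun _ _ => by positivity
      _ = _ := tsum_geometric_of_lt_one hq0 hq1
  -- As `F` is finite, the last step from the finest net to `F` costs `log F.card` times a vanishing
  -- radius.
  have hfin : ∀ k, ∫ ω, F.sup' hF (fun f => T f ω) ∂ν ≤ σ * chainingConst c s D +
      e k * (2 * σ * (Real.log F.card + 1 / 2)) := fun k => by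
    obtain ⟨A, hA, hAF, hAnet, hAint⟩ := hchain k
    have hx := he0 k
    have h := hstep F A hF hA le_rfl hAF (2 * e k) ((σ * (2 * e k))⁻¹) (by positivity)
      (by positivity) hAnet
    have h1 : (σ * (2 * e k)) ^ 2 * (σ * (2 * e k))⁻¹ / 2 = e k * (2 * σ * (1 / 2)) := by
      field_simp
    rw [h1, div_inv_eq_mul] at h
    have h2 : σ * ((c + 8) * D ^ α * ∑ j ∈ Finset.range k, q ^ (j + 1)) ≤
        σ * chainingConst c s D := by
      rw [chainingConst]
      have := hsum k
      gcongr
    linarith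
  have hlim : Tendsto (fun k => σ * chainingConst c s D +
      e k * (2 * σ * (Real.log F.card + 1 / 2))) atTop (𝓝 (σ * chainingConst c s D)) := by
    have : Tendsto e atTop (𝓝 0) := by
      simpa [he] using (tendsto_pow_atTop_nhds_zero_of_lt_one (r := (1 / 2 : ℝ)) (by norm_num)
        (by norm_num)).const_mul D
    simpa using (this.mul_const (2 * σ * (Real.log F.card + 1 / 2))).const_add
      (σ * chainingConst c s D)
  exact ge_of_tendsto' hlim hfin

end Chaining

/-! ### Symmetrization by random swaps -/

section Symmetrization

variable {Z : Type*} [MeasurableSpace Z]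

/-- The law of a fair coin. -/
noncomputable def coin : Measure Bool :=
  (2⁻¹ : ENNReal) • (Measure.dirac true + Measure.dirac false)

instance : IsProbabilityMeasure coin := ⟨by
  simp [coin, ENNReal.inv_two_add_inv_two]⟩

theorem measurePreserving_not_coin : MeasurePreserving not coin coin := by
  refine ⟨measurable_from_top, ?_⟩
  rw [coin, Measure.map_smul, Measure.map_add _ _ measurable_from_top,
    Measure.map_dirac' measurable_from_top, Measure.map_dirac' measurable_from_top, add_comm]
  rfl

/-- The law of `n` independent fair coins. -/
noncomputable abbrev coins (n : ℕ) : Measure (Fin n → Bool) := Measure.pi fun _ => coin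

/-- Select from a sample of pairs, coordinate by coordinate, the first or second component. -/
def select {n : ℕ} (σ : Fin n → Bool) (w : Fin n → Z × Z) (i : Fin n) : Z :=
  if σ i then (w i).1 else (w i).2

/-- Fair coins are invariant under flipping; this is why the symmetrized process is centred. -/
theorem integral_coins_not {n : ℕ} (F : (Fin n → Bool) → ℝ) :
    ∫ σ, F (fun i => !σ i) ∂(coins n) = ∫ σ, F σ ∂(coins n) := by
  have h := measurePreserving_pi (fun _ : Fin n => coin) (fun _ => coin)
    fun _ => measurePreserving_not_coin
  rw [← integral_map h.measurable.aemeasurable (f := F) (by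
    exact (measurable_of_finite F).aestronglyMeasurable), h.map_eq]

/-- Each coordinate is either left alone or swapped, and both operations preserve `μ.prod μ`; so the
selected and rejected samples are independent whatever the coins show. -/
theorem measurePreserving_select (μ : Measure Z) [IsProbabilityMeasure μ] {n : ℕ}
    (σ : Fin n → Bool) :
    MeasurePreserving (fun w : Fin n → Z × Z => (select σ w, select (fun i => !σ i) w))
      (Measure.pi fun _ => μ.prod μ) ((Measure.pi fun _ => μ).prod (Measure.pi fun _ => μ)) := by
  have h1 := measurePreserving_arrowProdEquivProdArrow Z Z (Fin n) (fun _ => μ) (fun _ => μ)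
  have h2 := measurePreserving_pi (fun _ : Fin n => μ.prod μ) (fun _ => μ.prod μ)
    (f := fun i => if σ i then id else Prod.swap) fun i => by
      by_cases h : σ i
      · simpa [h] using MeasurePreserving.id (μ.prod μ)
      · simpa [h] using Measure.measurePreserving_swap (μ := μ) (ν := μ)
  convert h1.comp h2 using 1
  funext w
  refine Prod.ext (funext fun i => ?_) (funext fun i => ?_) <;>
  · by_cases h : σ i <;>
      simp [select, h, MeasurableEquiv.arrowProdEquivProdArrow, Equiv.arrowProdEquivProdArrow]

theorem measurable_sup'_apply {Ω ι : Type*} [MeasurableSpace Ω] {F : Finset ι} (hF : F.Nonempty)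
    {X : ι → Ω → ℝ} (hX : ∀ f ∈ F, Measurable (X f)) :
    Measurable fun ω => F.sup' hF fun f => X f ω := by
  have h := Finset.measurable_sup' hF hX
  have h' : (fun ω => F.sup' hF fun f => X f ω) = F.sup' hF X := by
    funext ω; exact (Finset.sup'_apply hF X ω).symm
  rwa [h']

theorem abs_sup'_le {ι : Type*} {F : Finset ι} (hF : F.Nonempty) {x : ι → ℝ} {B : ℝ}
    (hx : ∀ f ∈ F, |x f| ≤ B) : |F.sup' hF x| ≤ B := by
  obtain ⟨f, hf, h⟩ := F.exists_mem_eq_sup' hF x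
  rw [h]
  exact hx f hf

theorem abs_sup'_sub_sup'_le {ι : Type*} {F : Finset ι} (hF : F.Nonempty) {x y : ι → ℝ} {B : ℝ}
    (hxy : ∀ f ∈ F, |x f - y f| ≤ B) : |F.sup' hF x - F.sup' hF y| ≤ B := by
  obtain ⟨f, hf, h⟩ := F.exists_mem_eq_sup' hF x
  obtain ⟨g, hg, h'⟩ := F.exists_mem_eq_sup' hF y
  have h1 := Finset.le_sup' y hf
  have h2 := Finset.le_sup' x hg
  have h3 := abs_le.1 (hxy f hf)
  have h4 := abs_le.1 (hxy g hg)
  rw [abs_le]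
  constructor <;> linarith

/-- **Symmetrization**: if the symmetrized process has mean maximum at most `K` for every sample of
pairs, then so has the centred process. -/
theorem integral_sup'_sub_integral_le {ι : Type*} (μ : Measure Z) [IsProbabilityMeasure μ] {n : ℕ}
    (F : Finset ι) (hF : F.Nonempty) (Ψ : ι → (Fin n → Z) → ℝ)
    (hΨ : ∀ f ∈ F, Measurable (Ψ f)) {B K : ℝ} (hB : ∀ f ∈ F, ∀ z, |Ψ f z| ≤ B)
    (hK : ∀ w : Fin n → Z × Z, ∫ σ, F.sup' hF (fun f =>
      Ψ f (select σ w) - Ψ f (select (fun i => !σ i) w)) ∂(coins n) ≤ K) :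
    ∫ z, F.sup' hF (fun f => Ψ f z - ∫ z', Ψ f z' ∂(Measure.pi fun _ => μ))
      ∂(Measure.pi fun _ => μ) ≤ K := by
  set P := Measure.pi fun _ : Fin n => μ with hP
  set W := Measure.pi fun _ : Fin n => μ.prod μ with hW
  set M : (Fin n → Z) × (Fin n → Z) → ℝ := fun q => F.sup' hF fun f => Ψ f q.1 - Ψ f q.2 with hM
  have hMm : Measurable M := measurable_sup'_apply hF fun f hf =>
    ((hΨ f hf).comp measurable_fst).sub ((hΨ f hf).comp measurable_snd)
  have hMB : ∀ q, |M q| ≤ B + B := fun q => abs_sup'_le hF fun f hf =>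
    (abs_sub _ _).trans (add_le_add (hB f hf _) (hB f hf _))
  have hMi : Integrable M (P.prod P) := integrable_of_abs_le hMm hMB
  -- The expectation becomes an average over a ghost sample, and a supremum of averages is at most
  -- the average of the suprema.
  have hfirst : ∫ z, F.sup' hF (fun f => Ψ f z - ∫ z', Ψ f z' ∂P) ∂P ≤ ∫ q, M q ∂(P.prod P) := by
    rw [integral_prod _ hMi]
    have hmean : ∀ f ∈ F, |∫ z', Ψ f z' ∂P| ≤ B := fun f hf => by
      simpa using norm_integral_le_of_norm_le_const (μ := P) (f := Ψ f)
        (Eventually.of_forall fun z => hB f hf z)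
    refine integral_mono (integrable_of_abs_le (B := B + B) (measurable_sup'_apply hF fun f hf =>
      (hΨ f hf).sub_const _) fun z => abs_sup'_le hF fun f hf =>
        (abs_sub _ _).trans (add_le_add (hB f hf z) (hmean f hf))) hMi.integral_prod_left fun z => ?_
    refine Finset.sup'_le _ _ fun f hf => ?_
    have hi : Integrable (Ψ f) P := integrable_of_abs_le (hΨ f hf) (hB f hf)
    have : Ψ f z - ∫ z', Ψ f z' ∂P = ∫ z', (Ψ f z - Ψ f z') ∂P := by
      rw [integral_sub (integrable_const _) hi]; simp
    rw [this]
    refine integral_mono ((integrable_const _).sub hi)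
      (integrable_of_abs_le (hMm.comp measurable_prodMk_left) fun z' => hMB (z, z')) fun z' => ?_
    exact Finset.le_sup' (fun f => Ψ f z - Ψ f z') hf
  have hsel : ∀ σ : Fin n → Bool, ∫ w, M (select σ w, select (fun i => !σ i) w) ∂W =
      ∫ q, M q ∂(P.prod P) := fun σ => by
    have h := measurePreserving_select μ σ (n := n)
    rw [← h.map_eq, integral_map h.measurable.aemeasurable]
    exact hMm.aestronglyMeasurable
  have hjm : Measurable fun q : (Fin n → Bool) × (Fin n → Z × Z) =>
      M (select q.1 q.2, select (fun i => !q.1 i) q.2) :=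
    measurable_from_prod_countable_right fun σ => hMm.comp (measurePreserving_select μ σ).measurable
  have hji := integrable_of_abs_le (ν := (coins n).prod W) hjm fun q => hMB _
  refine hfirst.trans ?_
  -- Averaging over the coins changes nothing because each swap preserves the law; Fubini then
  -- freezes the pairs. No additive structure of `Ψ` is used, so the double sum needs no decoupling.
  calc ∫ q, M q ∂(P.prod P)
      = ∫ σ, (∫ w, M (select σ w, select (fun i => !σ i) w) ∂W) ∂(coins n) := by
        simp_rw [hsel]; simp
    _ = ∫ w, (∫ σ, M (select σ w, select (fun i => !σ i) w) ∂(coins n)) ∂W :=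
        integral_integral_swap hji
    _ ≤ ∫ _w, K ∂W := integral_mono hji.swap.integral_prod_left (integrable_const _) hK
    _ = K := by simp

end Symmetrization

/-! ### Double sums -/

section PairSums

variable {Z : Type*}

/-- Changing one observation in a double sum `∑ᵢ ∑ⱼ t(zᵢ, zⱼ)`, where `|t(u, v)| ≤ b(u) + b(v)`. -/
theorem abs_sum_sum_sub_le {n : ℕ} (t : Z → Z → ℝ) (b : Z → ℝ) (hb : ∀ u, 0 ≤ b u)
    (ht : ∀ u v, |t u v| ≤ b u + b v) (z z' : Fin n → Z) (i : Fin n)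
    (hz : ∀ j, j ≠ i → z' j = z j) :
    |∑ j, ∑ k, t (z' j) (z' k) - ∑ j, ∑ k, t (z j) (z k)| ≤
      2 * (n * (b (z i) + b (z' i)) + ∑ k, (b (z k) + b (z' k))) := by
  set β : Fin n → ℝ := fun j => b (z j) + b (z' j) with hβ
  have hβ0 : ∀ j, 0 ≤ β j := fun j => add_nonneg (hb _) (hb _)
  -- Only row `i` and column `i` change; each contributes `n β i + ∑ k, β k`.
  have hterm : ∀ j k, |t (z' j) (z' k) - t (z j) (z k)| ≤
      (if j = i then β j + β k else 0) + (if k = i then β j + β k else 0) := fun j k => by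
    have hall : |t (z' j) (z' k) - t (z j) (z k)| ≤ β j + β k := by
      refine (abs_sub _ _).trans ((add_le_add (ht _ _) (ht _ _)).trans_eq ?_)
      simp only [hβ]; ring
    have hnn := add_nonneg (hβ0 j) (hβ0 k)
    by_cases hj : j = i
    · rw [if_pos hj]
      split_ifs <;> linarith
    · by_cases hk : k = i
      · rw [if_neg hj, if_pos hk]; linarith
      · simp [hz j hj, hz k hk, hj, hk]
  rw [← Finset.sum_sub_distrib]
  calc |∑ j, (∑ k, t (z' j) (z' k) - ∑ k, t (z j) (z k))|
      ≤ ∑ j, ∑ k, |t (z' j) (z' k) - t (z j) (z k)| := by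
        refine (Finset.abs_sum_le_sum_abs _ _).trans (Finset.sum_le_sum fun j _ => ?_)
        rw [← Finset.sum_sub_distrib]
        exact Finset.abs_sum_le_sum_abs _ _
    _ ≤ ∑ j, ∑ k, ((if j = i then β j + β k else 0) + (if k = i then β j + β k else 0)) :=
        Finset.sum_le_sum fun j _ => Finset.sum_le_sum fun k _ => hterm j k
    _ = 2 * (n * β i + ∑ k, β k) := by
        simp only [Finset.sum_add_distrib, Finset.sum_ite_eq', Finset.mem_univ, if_true]
        rw [Finset.sum_comm]
        simp [Finset.sum_add_distrib]
        ring

end PairSums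

/-! ### Pair means of errors and their symmetrized increments -/

variable {𝒳 : Type*}

/-- The mean `n⁻² ∑ᵢ ∑ⱼ k(eᵢ - eⱼ)` of a kernel over pairs of errors. -/
noncomputable def pairMean (k : ℝ → ℝ) {n : ℕ} (f : 𝒳 → ℝ) (z : Fin n → 𝒳 × ℝ) : ℝ :=
  1 / (n : ℝ) ^ 2 * ∑ i, ∑ j, k (err f (z i) - err f (z j))

theorem abs_pairMean_le {k : ℝ → ℝ} {B : ℝ} (hB : ∀ t, |k t| ≤ B) {n : ℕ} (f : 𝒳 → ℝ)
    (z : Fin n → 𝒳 × ℝ) : |pairMean k f z| ≤ B := by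
  have hB0 : 0 ≤ B := (abs_nonneg _).trans (hB 0)
  have h : |∑ i, ∑ j, k (err f (z i) - err f (z j))| ≤ (n : ℝ) ^ 2 * B := by
    refine (Finset.abs_sum_le_sum_abs _ _).trans ?_
    calc _ ≤ ∑ _i : Fin n, ∑ _j : Fin n, B := Finset.sum_le_sum fun i _ =>
          (Finset.abs_sum_le_sum_abs _ _).trans (Finset.sum_le_sum fun j _ => hB _)
      _ = _ := by simp; ring
  rw [pairMean, abs_mul, abs_of_nonneg (by positivity)]
  rcases Nat.eq_zero_or_pos n with rfl | hn
  · simpa using hB0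
  · rw [div_mul_eq_mul_div, one_mul, div_le_iff₀ (by positivity)]
    linarith

theorem measurable_err [MeasurableSpace 𝒳] {f : 𝒳 → ℝ} (hf : Measurable f) :
    Measurable (err f) :=
  measurable_snd.sub (hf.comp measurable_fst)

theorem measurable_pairMean [MeasurableSpace 𝒳] {k : ℝ → ℝ} (hk : Continuous k) {n : ℕ}
    {f : 𝒳 → ℝ} (hf : Measurable f) : Measurable (pairMean k f (n := n)) := by
  refine Measurable.const_mul ?_ _
  refine Finset.measurable_sum _ fun i _ => Finset.measurable_sum _ fun j _ => ?_
  exact hk.measurable.comp (((measurable_err hf).comp (measurable_pi_apply i)).sub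
    ((measurable_err hf).comp (measurable_pi_apply j)))

theorem continuous_pairMean [TopologicalSpace 𝒳] {k : ℝ → ℝ} (hk : Continuous k) {n : ℕ}
    {f : 𝒳 → ℝ} (hf : Continuous f) : Continuous (pairMean k f (n := n)) := by
  unfold pairMean err
  fun_prop

/-- The bounded differences of `pairMean k f`. -/
theorem abs_pairMean_update_sub_le {k : ℝ → ℝ} {B : ℝ} (hB : ∀ t, |k t| ≤ B) {n : ℕ}
    (f : 𝒳 → ℝ) (z : Fin n → 𝒳 × ℝ) (i : Fin n) (w : 𝒳 × ℝ) :
    |pairMean k f (Function.update z i w) - pairMean k f z| ≤ 4 * B / n := by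
  have hn : (0 : ℝ) < n := by exact_mod_cast i.pos
  have hB0 : 0 ≤ B := (abs_nonneg _).trans (hB 0)
  have h := abs_sum_sum_sub_le (fun u v => k (err f u - err f v)) (fun _ => B / 2)
    (fun _ => by positivity) (fun u v => (hB _).trans_eq (by ring)) z (Function.update z i w) i
    fun j hj => Function.update_of_ne hj _ _
  rw [pairMean, pairMean, ← mul_sub, abs_mul, abs_of_nonneg (by positivity)]
  calc _ ≤ 1 / (n : ℝ) ^ 2 * _ := mul_le_mul_of_nonneg_left h (by positivity)
    _ = _ := by simp; field_simp; ring

/-- The bounded differences, under a change of sign, of the increments of the symmetrized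
process. -/
theorem abs_symmetrized_update_sub_le {k : ℝ → ℝ} {L : ℝ} (hL : ∀ a b, |k a - k b| ≤ L * |a - b|)
    {n : ℕ} (f g : 𝒳 → ℝ) (w : Fin n → (𝒳 × ℝ) × (𝒳 × ℝ)) (σ : Fin n → Bool) (i : Fin n)
    (s : Bool) {a : Fin n → ℝ}
    (ha : ∀ i, |f (w i).1.1 - g (w i).1.1| + |f (w i).2.1 - g (w i).2.1| = a i) :
    |(pairMean k f (select (Function.update σ i s) w) - pairMean k g (select (Function.update σ i s) w)) -
      (pairMean k f (select σ w) - pairMean k g (select σ w))| ≤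
      4 * L / (n : ℝ) ^ 2 * (n * a i + ∑ j, a j) := by
  have hL0 : 0 ≤ L := by simpa using (abs_nonneg _).trans (hL 1 0)
  -- The response cancels in `err f u - err g u`, so the Lipschitz property bounds the increments by
  -- the values of `f - g` at the inputs alone.
  set b : 𝒳 × ℝ → ℝ := fun u => L * |f u.1 - g u.1| with hbdef
  have h := abs_sum_sum_sub_le
    (fun u v => k (err f u - err f v) - k (err g u - err g v)) b
    (fun u => by positivity) (fun u v => ?_) (select σ w) (select (Function.update σ i s) w) i
    fun j hj => by simp [select, Function.update_of_ne hj]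
  · simp only [Finset.sum_sub_distrib] at h
    have hb : ∀ (σ : Fin n → Bool) j, b (select σ w j) ≤ L * a j := fun σ j => by
      rw [← ha j, hbdef]
      refine mul_le_mul_of_nonneg_left ?_ hL0
      unfold select
      split_ifs
      · exact le_add_of_nonneg_right (abs_nonneg _)
      · exact le_add_of_nonneg_left (abs_nonneg _)
    unfold pairMean
    rw [← mul_sub, ← mul_sub, ← mul_sub, abs_mul, abs_of_nonneg (by positivity)]
    calc _ ≤ 1 / (n : ℝ) ^ 2 * (2 * (n * (L * a i + L * a i) + ∑ j, (L * a j + L * a j))) := by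
          refine mul_le_mul_of_nonneg_left (h.trans ?_) (by positivity)
          gcongr <;> apply hb
      _ = _ := by
          rw [Finset.sum_add_distrib, ← Finset.mul_sum]; ring
  · refine (hL _ _).trans ?_
    rw [hbdef, ← mul_add]
    refine mul_le_mul_of_nonneg_left ?_ hL0
    unfold err
    rw [show u.2 - f u.1 - (v.2 - f v.1) - (u.2 - g u.1 - (v.2 - g v.1)) =
      -(f u.1 - g u.1) + (f v.1 - g v.1) by ring]
    refine (abs_add_le _ _).trans_eq ?_
    rw [abs_neg]

/-- The `2n` inputs of a sample of `n` pairs. -/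
def pairInputs {n : ℕ} (w : Fin n → (𝒳 × ℝ) × (𝒳 × ℝ)) : Fin (n + n) → 𝒳 :=
  Fin.append (fun i => (w i).1.1) (fun i => (w i).2.1)

theorem d2_sq_pairInputs {n : ℕ} (w : Fin n → (𝒳 × ℝ) × (𝒳 × ℝ)) (f g : 𝒳 → ℝ) :
    d2 (fun i => f (pairInputs w i)) (fun i => g (pairInputs w i)) ^ 2 =
      1 / (2 * n) * ∑ i, (|f (w i).1.1 - g (w i).1.1| ^ 2 + |f (w i).2.1 - g (w i).2.1| ^ 2) := by
  rw [d2, Real.sq_sqrt (by positivity), Fin.sum_univ_add, Finset.sum_add_distrib]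
  simp only [pairInputs, Fin.append_left, Fin.append_right]
  push_cast
  rw [← two_mul]

/-- The increments of the symmetrized process are sub-Gaussian for the metric `d2`. -/
theorem integral_exp_symmetrized_le {k : ℝ → ℝ} {B L : ℝ} (hB : ∀ t, |k t| ≤ B)
    (hL : ∀ a b, |k a - k b| ≤ L * |a - b|) {n : ℕ} (hn : 0 < n) (f g : 𝒳 → ℝ)
    (w : Fin n → (𝒳 × ℝ) × (𝒳 × ℝ)) (l : ℝ) :
    ∫ σ, Real.exp (l * ((pairMean k f (select σ w) - pairMean k f (select (fun i => !σ i) w)) -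
        (pairMean k g (select σ w) - pairMean k g (select (fun i => !σ i) w)))) ∂(coins n) ≤
      Real.exp ((16 * L / Real.sqrt n *
        d2 (fun i => f (pairInputs w i)) (fun i => g (pairInputs w i))) ^ 2 * l ^ 2 / 2) := by
  have hL0 : 0 ≤ L := by simpa using (abs_nonneg _).trans (hL 1 0)
  have hn' : (0 : ℝ) < n := by exact_mod_cast hn
  set a : Fin n → ℝ := fun i => |f (w i).1.1 - g (w i).1.1| + |f (w i).2.1 - g (w i).2.1| with ha
  have ha0 : ∀ i, 0 ≤ a i := fun i => by positivity
  set D : (Fin n → Bool) → ℝ := fun σ => pairMean k f (select σ w) - pairMean k g (select σ w)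
    with hD
  have hDu := fun σ i s => abs_symmetrized_update_sub_le hL f g w σ i s (a := a) fun _ => rfl
  -- Flipping one coin changes both `D σ` and its mirror image, so the differences of `D` double.
  set T : (Fin n → Bool) → ℝ := fun σ => D σ - D (fun i => !σ i) with hT
  have hTeq : ∀ σ, (pairMean k f (select σ w) - pairMean k f (select (fun i => !σ i) w)) -
      (pairMean k g (select σ w) - pairMean k g (select (fun i => !σ i) w)) = T σ := fun σ => by
    simp only [hT, hD]; ring
  simp_rw [hTeq]
  have hmean : ∫ σ, T σ ∂(coins n) = 0 := by
    rw [hT, integral_sub Integrable.of_finite Integrable.of_finite, integral_coins_not D, sub_self]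
  set c : Fin n → ℝ := fun i => 8 * L / (n : ℝ) ^ 2 * (n * a i + ∑ j, a j) with hc
  have hc0 : ∀ i, 0 ≤ c i := fun i => by
    have := Finset.sum_nonneg fun j (_ : j ∈ Finset.univ) => ha0 j
    have := ha0 i
    positivity
  set c' : Fin n → ℝ≥0 := fun i => ⟨c i, hc0 i⟩ with hc'
  have hTb : ∀ σ, |T σ| ≤ 4 * B := fun σ => by
    rw [← hTeq]
    have h1 := abs_le.1 (abs_pairMean_le hB f (select σ w))
    have h2 := abs_le.1 (abs_pairMean_le hB f (select (fun i => !σ i) w))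
    have h3 := abs_le.1 (abs_pairMean_le hB g (select σ w))
    have h4 := abs_le.1 (abs_pairMean_le hB g (select (fun i => !σ i) w))
    rw [abs_le]
    constructor <;> linarith
  have hTd : ∀ σ i s, |T (Function.update σ i s) - T σ| ≤ c' i := fun σ i s => by
    have h1 := hDu σ i s
    have h2 := hDu (fun i => !σ i) i (!s)
    have h3 : (fun j => !(Function.update σ i s j)) = Function.update (fun j => !σ j) i (!s) := by
      funext j
      by_cases hj : j = i
      · subst hj; simp
      · simp [Function.update_of_ne hj]
    change _ ≤ c i
    simp only [hT, h3]
    rw [show ∀ x y u v : ℝ, x - y - (u - v) = (x - u) - (y - v) by intros; ring]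
    refine (abs_sub _ _).trans ((add_le_add h1 h2).trans_eq ?_)
    simp only [hc]; ring
  have hsub := hasSubgaussianMGF_of_boundedDifferences coin (measurable_of_finite T) hTb hTd
  have hmgf := hsub.mgf_le l
  rw [hmean] at hmgf
  simp only [mgf, sub_zero] at hmgf
  refine hmgf.trans (Real.exp_le_exp.2 ?_)
  -- Cauchy–Schwarz gives `∑ (n aᵢ + S)² ≤ 4n² ∑ aᵢ²`, and `∑ aᵢ² ≤ 2Q` with `Q = 2n d2²`;
  -- multiplied by `(4L/n²)²` this is `256 L² d2² / n`.
  have hsum : ∑ i, (c i / 2) ^ 2 ≤ (16 * L / Real.sqrt n *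
        d2 (fun i => f (pairInputs w i)) (fun i => g (pairInputs w i))) ^ 2 := by
    rw [mul_pow, d2_sq_pairInputs, div_pow, Real.sq_sqrt hn'.le]
    set S := ∑ j, a j with hS
    set Q := ∑ i, (|f (w i).1.1 - g (w i).1.1| ^ 2 + |f (w i).2.1 - g (w i).2.1| ^ 2) with hQ
    have h1 : ∑ i, a i ^ 2 ≤ 2 * Q := by
      rw [hQ, Finset.mul_sum]
      exact Finset.sum_le_sum fun i _ => add_sq_le
    have h2 : S ^ 2 ≤ n * ∑ i, a i ^ 2 := by
      simpa using sq_sum_le_card_mul_sum_sq (s := Finset.univ) (f := a)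
    have h3 : ∑ i, (n * a i + S) ^ 2 ≤ 4 * (n : ℝ) ^ 2 * ∑ i, a i ^ 2 := by
      calc _ ≤ ∑ i, (2 * ((n * a i) ^ 2 + S ^ 2)) := Finset.sum_le_sum fun i _ => add_sq_le
        _ = 2 * (n : ℝ) ^ 2 * ∑ i, a i ^ 2 + 2 * n * S ^ 2 := by
            simp only [mul_add, Finset.sum_add_distrib, mul_pow, Finset.sum_const,
              Finset.card_univ, Fintype.card_fin, nsmul_eq_mul]
            simp only [← Finset.mul_sum]
            ring
        _ ≤ 2 * (n : ℝ) ^ 2 * ∑ i, a i ^ 2 + 2 * n * (n * ∑ i, a i ^ 2) := by gcongr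
        _ = _ := by ring
    calc ∑ i, (c i / 2) ^ 2 = (4 * L / (n : ℝ) ^ 2) ^ 2 * ∑ i, (n * a i + S) ^ 2 := by
          rw [Finset.mul_sum]
          refine Finset.sum_congr rfl fun i _ => ?_
          simp only [hc]; ring
      _ ≤ (4 * L / (n : ℝ) ^ 2) ^ 2 * (4 * (n : ℝ) ^ 2 * (2 * Q)) := by
          refine mul_le_mul_of_nonneg_left (h3.trans ?_) (by positivity)
          gcongr
      _ = (16 * L) ^ 2 / n * (1 / (2 * n) * Q) := by field_simp; ring
  have hcoe : ((∑ i, (c' i / 2) ^ 2 : ℝ≥0) : ℝ) = ∑ i, (c i / 2) ^ 2 := by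
    push_cast; rfl
  rw [hcoe]
  gcongr

/-! ### Uniform deviation over the hypothesis space -/

/-- A finite covering by balls with arbitrary centres yields a net inside the covered set. -/
theorem exists_net_of_empiricalCoveringNumber {H : Set (𝒳 → ℝ)} {ε : ℝ}
    (hfin : empiricalCoveringNumber H ε ≠ ⊤) {N : ℕ} (hN : 0 < N) (x : Fin N → 𝒳)
    (F : Finset (𝒳 → ℝ)) (hFH : ∀ f ∈ F, f ∈ H) :
    ∃ A ⊆ F, Real.log A.card ≤ Real.log ((empiricalCoveringNumber H ε).toNat : ℝ) ∧
      ∀ f ∈ F, ∃ a ∈ A, d2 (fun i => f (x i)) (fun i => a (x i)) ≤ 2 * ε := by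
  classical
  set m := (empiricalCoveringNumber H ε).toNat with hm
  have hmt : empiricalCoveringNumber H ε = m := (ENat.natCast_toNat hfin).symm
  have hle : coveringNumber ((fun (f : 𝒳 → ℝ) (i : Fin N) => f (x i)) '' H) ε d2 ≤ m := by
    rw [← hmt]
    exact le_iSup_of_le N (le_iSup_of_le hN (le_iSup_of_le x le_rfl))
  have hlt : coveringNumber ((fun (f : 𝒳 → ℝ) (i : Fin N) => f (x i)) '' H) ε d2 <
      ((m + 1 : ℕ) : ℕ∞) := lt_of_le_of_lt hle (by exact_mod_cast Nat.lt_succ_self m)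
  unfold coveringNumber at hlt
  simp only [iInf_lt_iff] at hlt
  obtain ⟨T, hT, hcard⟩ := hlt
  have hTm : T.card ≤ m := Nat.lt_succ_iff.1 (by exact_mod_cast hcard)
  -- Balls missing `F` are dropped, and each remaining centre is replaced by a member of `F` in its
  -- ball. The cardinality does not grow and the radius doubles.
  set T' := T.filter fun b => ∃ f ∈ F, d2 (fun i => f (x i)) b < ε with hT'
  have hT'e : ∀ b ∈ T', ∃ f ∈ F, d2 (fun i => f (x i)) b < ε := fun b hb =>
    (Finset.mem_filter.1 hb).2
  choose! c hcF hc using hT'e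
  refine ⟨T'.image c, Finset.image_subset_iff.2 hcF, ?_, fun f hf => ?_⟩
  · rcases Nat.eq_zero_or_pos (T'.image c).card with h0 | h0
    · rw [h0]
      simpa using Real.log_natCast_nonneg m
    · refine Real.log_le_log (by exact_mod_cast h0) ?_
      exact_mod_cast (Finset.card_image_le.trans (Finset.card_filter_le _ _)).trans hTm
  · obtain ⟨b, hb, hfb⟩ := hT _ (Set.mem_image_of_mem _ (hFH f hf))
    have hb' : b ∈ T' := Finset.mem_filter.2 ⟨hb, f, hf, hfb⟩
    refine ⟨c b, Finset.mem_image_of_mem c hb', ?_⟩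
    have h2 := hc b hb'
    have htri : d2 (fun i => f (x i)) (fun i => c b (x i)) ≤
        d2 (fun i => f (x i)) b + d2 (fun i => c b (x i)) b := by
      -- `d2` is a rescaled Euclidean distance, which supplies the triangle inequality.
      have key : ∀ u v : Fin N → ℝ, d2 u v =
          Real.sqrt (1 / (N : ℝ)) * dist (WithLp.toLp 2 u) (WithLp.toLp 2 v) := fun u v => by
        rw [d2, Real.sqrt_mul (by positivity), EuclideanSpace.dist_eq]
        simp [Real.dist_eq]
      rw [key, key, key, ← mul_add]
      exact mul_le_mul_of_nonneg_left (dist_triangle_right _ _ _) (Real.sqrt_nonneg _)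
    linarith

theorem d2_le_of_abs_sub_le {N : ℕ} {u v : Fin N → ℝ} {D : ℝ} (hD : 0 ≤ D)
    (h : ∀ i, |u i - v i| ≤ D) : d2 u v ≤ D := by
  refine Real.sqrt_le_iff.2 ⟨hD, ?_⟩
  rcases Nat.eq_zero_or_pos N with rfl | hN
  · simpa using sq_nonneg D
  have hN' : (0 : ℝ) < N := by exact_mod_cast hN
  rw [div_mul_eq_mul_div, one_mul, div_le_iff₀ hN']
  calc ∑ i, |u i - v i| ^ 2 ≤ ∑ _i : Fin N, D ^ 2 :=
        Finset.sum_le_sum fun i _ => pow_le_pow_left₀ (abs_nonneg _) (h i) 2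
    _ = D ^ 2 * N := by simp [mul_comm]

/-- The mean of the largest deviation of the pair means over a finite class. -/
theorem integral_sup'_pairMean_le [MeasurableSpace 𝒳] (ρ : Measure (𝒳 × ℝ))
    [IsProbabilityMeasure ρ] {k : ℝ → ℝ} (hk : Continuous k) {B L : ℝ} (hB : ∀ t, |k t| ≤ B)
    (hL0 : 0 < L) (hL : ∀ a b, |k a - k b| ≤ L * |a - b|) {H : Set (𝒳 → ℝ)} {c s D : ℝ}
    (hc : 0 ≤ c) (hs : s < 2) (hD : 0 < D) (hHD : ∀ f ∈ H, ∀ x, |f x| ≤ D)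
    (hH : ∀ ε : ℝ, 0 < ε → empiricalCoveringNumber H ε ≠ ⊤ ∧
      Real.log ((empiricalCoveringNumber H ε).toNat : ℝ) ≤ c * ε ^ (-s))
    {n : ℕ} (hn : 0 < n) (F : Finset (𝒳 → ℝ)) (hF : F.Nonempty) (hFH : ∀ f ∈ F, f ∈ H)
    (hFm : ∀ f ∈ F, Measurable f) :
    ∫ z, F.sup' hF (fun f => pairMean k f z - ∫ z', pairMean k f z' ∂(sampleLaw ρ n))
      ∂(sampleLaw ρ n) ≤ 16 * L / Real.sqrt n * chainingConst c s D := by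
  have hn' : (0 : ℝ) < n := by exact_mod_cast hn
  refine integral_sup'_sub_integral_le ρ F hF (fun f => pairMean k f)
    (fun f hf => measurable_pairMean hk (hFm f hf)) (fun f _ z => abs_pairMean_le hB f z) fun w => ?_
  refine integral_sup'_le_chainingConst F hF (fun f σ => pairMean k f (select σ w) -
    pairMean k f (select (fun i => !σ i) w))
    (fun f g => d2 (fun i => f (pairInputs w i)) (fun i => g (pairInputs w i)))
    (by positivity) hc hs hD (fun f _ => ?_) (fun _ _ _ _ => Real.sqrt_nonneg _)
    (fun f _ g _ l => integral_exp_symmetrized_le hB hL hn f g w l) (fun f hf g hg => ?_)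
    fun ε hε => ?_
  · rw [integral_sub Integrable.of_finite Integrable.of_finite,
      integral_coins_not (fun σ => pairMean k f (select σ w)), sub_self]
  · refine d2_le_of_abs_sub_le (by positivity) fun i => (abs_sub _ _).trans ?_
    linarith [hHD f (hFH f hf) (pairInputs w i), hHD g (hFH g hg) (pairInputs w i)]
  · obtain ⟨A, hAF, hA, hnet⟩ := exists_net_of_empiricalCoveringNumber (hH ε hε).1
      (Nat.add_pos_left hn n) (pairInputs w) F hFH
    exact ⟨A, hAF, hA.trans (hH ε hε).2, hnet⟩

/-- The centred pair mean of `f` minus that of a reference function `g`. -/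
noncomputable def pairDeviation [MeasurableSpace 𝒳] (ρ : Measure (𝒳 × ℝ)) (k : ℝ → ℝ) {n : ℕ}
    (g f : 𝒳 → ℝ) (z : Fin n → 𝒳 × ℝ) : ℝ :=
  (pairMean k f z - ∫ z', pairMean k f z' ∂(sampleLaw ρ n)) -
    (pairMean k g z - ∫ z', pairMean k g z' ∂(sampleLaw ρ n))

/-- Concentration of the largest deviation over a finite class. -/
theorem sampleLaw_exists_mem_finset_le [MeasurableSpace 𝒳] (ρ : Measure (𝒳 × ℝ))
    [IsProbabilityMeasure ρ] {k : ℝ → ℝ} (hk : Continuous k) {B K : ℝ} (hB0 : 0 < B)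
    (hB : ∀ t, |k t| ≤ B) {n : ℕ} {g : 𝒳 → ℝ} (hg : Measurable g)
    (F : Finset (𝒳 → ℝ)) (hF : F.Nonempty) (hFm : ∀ f ∈ F, Measurable f)
    (hK : ∫ z, F.sup' hF (fun f => pairMean k f z - ∫ z', pairMean k f z' ∂(sampleLaw ρ n))
      ∂(sampleLaw ρ n) ≤ K) {τ : ℝ} (hτ : 0 ≤ τ) :
    sampleLaw ρ n {z | ∃ f ∈ F, K + τ < pairDeviation ρ k g f z} ≤
      ENNReal.ofReal (Real.exp (-(τ ^ 2 * n) / (32 * B ^ 2))) := by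
  have hprob : IsProbabilityMeasure (sampleLaw ρ n) := by unfold sampleLaw; infer_instance
  set c : (𝒳 → ℝ) → ℝ := fun f => ∫ z', pairMean k f z' ∂(sampleLaw ρ n) with hc
  set S : (Fin n → 𝒳 × ℝ) → ℝ := fun z => F.sup' hF fun f => pairMean k f z - c f with hS
  -- Subtracting the centred term at `g` leaves the mean unchanged, and one application of
  -- McDiarmid's inequality then controls both functions at once.
  set Φ : (Fin n → 𝒳 × ℝ) → ℝ := fun z => S z - (pairMean k g z - c g) with hΦ
  have hcB : ∀ f, |c f| ≤ B := fun f => by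
    simpa using norm_integral_le_of_norm_le_const (μ := sampleLaw ρ n) (f := pairMean k f)
      (Eventually.of_forall fun z => abs_pairMean_le hB f z)
  have hcent : ∀ f (z : Fin n → 𝒳 × ℝ), |pairMean k f z - c f| ≤ B + B := fun f z =>
    (abs_sub _ _).trans (add_le_add (abs_pairMean_le hB f z) (hcB f))
  have hSm : Measurable S := measurable_sup'_apply hF fun f hf =>
    (measurable_pairMean hk (hFm f hf)).sub_const _
  have hgm : Measurable fun z : Fin n → 𝒳 × ℝ => pairMean k g z - c g :=
    (measurable_pairMean hk hg).sub_const _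
  have hΦm : Measurable Φ := hSm.sub hgm
  have hSB : ∀ z, |S z| ≤ B + B := fun z => abs_sup'_le hF fun f _ => hcent f z
  have hΦB : ∀ z, |Φ z| ≤ (B + B) + (B + B) := fun z =>
    (abs_sub _ _).trans (add_le_add (hSB z) (hcent g z))
  have hΦd : ∀ z i w, |Φ (Function.update z i w) - Φ z| ≤
      ((fun _ => (8 * B / n).toNNReal : Fin n → ℝ≥0) i : ℝ≥0) := fun z i w => by
    rw [Real.coe_toNNReal _ (by positivity)]
    have h1 : |S (Function.update z i w) - S z| ≤ 4 * B / n := abs_sup'_sub_sup'_le hF fun f _ => by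
      rw [sub_sub_sub_cancel_right]
      exact abs_pairMean_update_sub_le hB f z i w
    have h2 := abs_pairMean_update_sub_le hB g z i w
    have h3 : Φ (Function.update z i w) - Φ z = (S (Function.update z i w) - S z) -
        (pairMean k g (Function.update z i w) - pairMean k g z) := by simp only [hΦ]; ring
    rw [h3]
    exact (abs_sub _ _).trans ((add_le_add h1 h2).trans_eq (by ring))
  have hmean : ∫ z, Φ z ∂(sampleLaw ρ n) ≤ K := by
    have hgi : Integrable (pairMean k g) (sampleLaw ρ n) :=
      integrable_of_abs_le (measurable_pairMean hk hg) fun z => abs_pairMean_le hB g z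
    rw [hΦ, integral_sub (integrable_of_abs_le hSm hSB)
      (integrable_of_abs_le hgm fun z => hcent g z), integral_sub hgi (integrable_const _)]
    simpa [hc] using hK
  have hsub := hasSubgaussianMGF_of_boundedDifferences ρ hΦm hΦB hΦd
  have htail := hsub.measure_ge_le hτ
  have hincl : {z | ∃ f ∈ F, K + τ < pairDeviation ρ k g f z} ⊆
      {z | τ ≤ Φ z - ∫ z', Φ z' ∂(sampleLaw ρ n)} := by
    rintro z ⟨f, hf, hz⟩
    have h1 := Finset.le_sup' (fun f => pairMean k f z - c f) hf
    simp only [Set.mem_ofPred_eq, hΦ, hS] at *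
    unfold pairDeviation at hz
    linarith
  refine (measure_mono hincl).trans ?_
  rw [← ENNReal.ofReal_toReal (measure_ne_top (sampleLaw ρ n) _)]
  refine ENNReal.ofReal_le_ofReal (htail.trans (Real.exp_le_exp.2 ?_))
  rcases Nat.eq_zero_or_pos n with rfl | hn
  · simp
  have hn' : (0 : ℝ) < n := by exact_mod_cast hn
  -- Differences `4B/n` from the supremum and from `g` add to `8B/n`; halved, squared and summed
  -- they give `16B²/n`, whence the `32` in the exponent.
  have hcoe : ((∑ _i : Fin n, ((8 * B / n).toNNReal / 2) ^ 2 : ℝ≥0) : ℝ) = 16 * B ^ 2 / n := by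
    rw [Finset.sum_const, Finset.card_univ, Fintype.card_fin, nsmul_eq_mul, NNReal.coe_mul,
      NNReal.coe_pow, NNReal.coe_div, Real.coe_toNNReal _ (show 0 ≤ 8 * B / n by positivity),
      NNReal.coe_natCast]
    push_cast
    field_simp
    norm_num
  rw [hcoe]
  apply le_of_eq
  field_simp
  ring

/-- An outer bound for a union of open sets over an arbitrary index set follows from bounds for
the finite unions, if the measure is carried by a separable set. -/
theorem measure_iUnion_le_of_finset {E ι : Type*} [PseudoMetricSpace E] [MeasurableSpace E]
    (μ : Measure E) {A : Set E} (hA : TopologicalSpace.IsSeparable A) (hμA : ∀ᵐ z ∂μ, z ∈ A)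
    (U : ι → Set E) (hU : ∀ i, IsOpen (U i)) {r : ENNReal}
    (hfin : ∀ F : Finset ι, μ (⋃ i ∈ F, U i) ≤ r) : μ (⋃ i, U i) ≤ r := by
  have : TopologicalSpace.SeparableSpace A := hA.separableSpace
  have : SecondCountableTopology A := UniformSpace.secondCountable_of_separable A
  -- The separable carrier is second countable, so the Lindelöf property leaves countably many
  -- indices. These are then exhausted by finite sets, and continuity from below for a directed
  -- family finishes.
  obtain ⟨T, hT, hTU⟩ := TopologicalSpace.isOpen_iUnion_countable
    (fun i => ((↑) : A → E) ⁻¹' (U i)) fun i => (hU i).preimage continuous_subtype_val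
  have hsub : (⋃ i, U i) ∩ A ⊆ ⋃ i ∈ T, U i := by
    rintro z ⟨hz, hzA⟩
    have : (⟨z, hzA⟩ : A) ∈ ⋃ i ∈ T, ((↑) : A → E) ⁻¹' (U i) := by
      rw [hTU]
      simpa using hz
    simpa using this
  have hle : μ (⋃ i, U i) ≤ μ (⋃ i ∈ T, U i) := by
    refine measure_mono_ae ?_
    filter_upwards [hμA] with z hzA hz
    exact hsub ⟨hz, hzA⟩
  refine hle.trans ?_
  have := hT.to_subtype
  have hunion : ⋃ i ∈ T, U i = ⋃ F : Finset T, ⋃ i ∈ F, U i := by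
    ext z
    simp only [Set.mem_iUnion]
    constructor
    · rintro ⟨i, hi, hz⟩
      exact ⟨{⟨i, hi⟩}, ⟨i, hi⟩, Finset.mem_singleton_self _, hz⟩
    · rintro ⟨F, i, -, hz⟩
      exact ⟨i, i.2, hz⟩
  have hdir : Directed (· ⊆ ·) fun F : Finset T => ⋃ i ∈ F, U i :=
    Monotone.directed_le fun F G hFG => Set.biUnion_subset_biUnion_left hFG
  rw [hunion, hdir.measure_iUnion]
  refine iSup_le fun F => (measure_mono ?_).trans (hfin (F.map (Function.Embedding.subtype _)))
  intro z hz
  simp only [Set.mem_iUnion] at hz ⊢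
  obtain ⟨i, hi, hz⟩ := hz
  exact ⟨i, Finset.mem_map_of_mem _ hi, hz⟩

/-- Uniform concentration of the pair means over the hypothesis space. -/
theorem sampleLaw_exists_mem_le [MetricSpace 𝒳] [MeasurableSpace 𝒳] [BorelSpace 𝒳]
    (ρ : Measure (𝒳 × ℝ)) [IsProbabilityMeasure ρ]
    (hsep : ∃ S : Set 𝒳, TopologicalSpace.IsSeparable S ∧ ∀ᵐ x ∂ρ.fst, x ∈ S)
    {k : ℝ → ℝ} (hk : Continuous k) {B L : ℝ} (hB0 : 0 < B) (hB : ∀ t, |k t| ≤ B)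
    (hL0 : 0 < L) (hL : ∀ a b, |k a - k b| ≤ L * |a - b|) {H : Set (𝒳 → ℝ)} {c s D : ℝ}
    (hc : 0 ≤ c) (hs : s < 2) (hD : 0 < D) (hHc : ∀ f ∈ H, Continuous f)
    (hHD : ∀ f ∈ H, ∀ x, |f x| ≤ D)
    (hH : ∀ ε : ℝ, 0 < ε → empiricalCoveringNumber H ε ≠ ⊤ ∧
      Real.log ((empiricalCoveringNumber H ε).toNat : ℝ) ≤ c * ε ^ (-s))
    {g : 𝒳 → ℝ} (hg : g ∈ H) {n : ℕ} (hn : 0 < n) {τ : ℝ} (hτ : 0 ≤ τ) :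
    sampleLaw ρ n {z | ∃ f ∈ H, 16 * L / Real.sqrt n * chainingConst c s D + τ <
      pairDeviation ρ k g f z} ≤ ENNReal.ofReal (Real.exp (-(τ ^ 2 * n) / (32 * B ^ 2))) := by
  set K := 16 * L / Real.sqrt n * chainingConst c s D with hK
  obtain ⟨S, hS, hρS⟩ := hsep
  -- The sample space need not be separable, but the product of carriers is and has full measure.
  set A : Set (Fin n → 𝒳 × ℝ) := Set.univ.pi fun _ => S ×ˢ (Set.univ : Set ℝ) with hA
  have hAsep : TopologicalSpace.IsSeparable A := TopologicalSpace.IsSeparable.univ_pi fun _ =>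
    hS.prod (.of_separableSpace _)
  have hAae : ∀ᵐ z ∂(sampleLaw ρ n), z ∈ A := by
    have h1 : ∀ᵐ u ∂ρ, u.1 ∈ S := ae_of_ae_map measurable_fst.aemeasurable hρS
    have h2 : ∀ i : Fin n, ∀ᵐ z ∂(sampleLaw ρ n), (z i).1 ∈ S := fun i =>
      (Measure.quasiMeasurePreserving_eval (fun _ : Fin n => ρ) i).ae h1
    filter_upwards [ae_all_iff.2 h2] with z hz i _
    exact ⟨hz i, Set.mem_univ _⟩
  have hset : {z | ∃ f ∈ H, K + τ < pairDeviation ρ k g f z} =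
      ⋃ f : H, {z : Fin n → 𝒳 × ℝ | K + τ < pairDeviation ρ k g f z} := by
    ext z; simp
  rw [hset]
  refine measure_iUnion_le_of_finset _ hAsep hAae _ (fun f => ?_) fun F => ?_
  · exact isOpen_lt continuous_const (((continuous_pairMean hk (hHc f f.2)).sub
      continuous_const).sub ((continuous_pairMean hk (hHc g hg)).sub continuous_const))
  · set F' : Finset (𝒳 → ℝ) := F.map (Function.Embedding.subtype _) with hF'
    have hF'H : ∀ f ∈ F', f ∈ H := fun f hf => by
      obtain ⟨f', -, rfl⟩ := Finset.mem_map.1 hf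
      exact f'.2
    have hF'm : ∀ f ∈ F', Measurable f := fun f hf => (hHc f (hF'H f hf)).measurable
    rcases F'.eq_empty_or_nonempty with h0 | hne
    · have : F = ∅ := Finset.map_eq_empty.1 h0
      simp [this]
    refine (measure_mono ?_).trans (sampleLaw_exists_mem_finset_le ρ hk hB0 hB
      (hHc g hg).measurable F' hne hF'm
      (integral_sup'_pairMean_le ρ hk hB hL0 hL hc hs hD hHD hH hn F' hne hF'H hF'm) hτ)
    intro z hz
    simp only [Set.mem_iUnion] at hz
    obtain ⟨f, hf, hz⟩ := hz
    exact ⟨f, Finset.mem_map_of_mem _ hf, hz⟩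

/-! ### The Gaussian kernel -/

section GaussKernel

theorem gaussKernel_eq_gaussianPDFReal {h : ℝ} (hh : 0 < h) (t : ℝ) :
    gaussKernel h t = gaussianPDFReal 0 (h ^ 2).toNNReal t := by
  rw [gaussKernel, gaussianPDFReal, Real.coe_toNNReal _ (by positivity),
    Real.sqrt_mul (x := 2 * Real.pi) (by positivity), Real.sqrt_sq hh.le, sub_zero, one_div]

theorem gaussKernel_pos {h : ℝ} (hh : 0 < h) (t : ℝ) : 0 < gaussKernel h t := by
  unfold gaussKernel; positivity

theorem continuous_gaussKernel (h : ℝ) : Continuous (gaussKernel h) := by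
  unfold gaussKernel; fun_prop

theorem one_le_sqrt_two_pi : 1 ≤ Real.sqrt (2 * Real.pi) :=
  Real.one_le_sqrt.2 (by linarith [Real.pi_gt_three])

theorem gaussKernel_le {h : ℝ} (hh : 0 < h) (t : ℝ) : gaussKernel h t ≤ 1 / h := by
  unfold gaussKernel
  have h1 : Real.exp (-(t ^ 2) / (2 * h ^ 2)) ≤ 1 := by
    rw [Real.exp_le_one_iff, neg_div]
    exact neg_nonpos.2 (by positivity)
  have h2 : 1 / (Real.sqrt (2 * Real.pi) * h) ≤ 1 / h := by
    apply one_div_le_one_div_of_le hh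
    nlinarith [one_le_sqrt_two_pi]
  calc _ ≤ 1 / (Real.sqrt (2 * Real.pi) * h) * 1 := by gcongr
    _ ≤ _ := by rwa [mul_one]

theorem abs_gaussKernel_le {h : ℝ} (hh : 0 < h) (t : ℝ) : |gaussKernel h t| ≤ 1 / h := by
  rw [abs_of_pos (gaussKernel_pos hh t)]
  exact gaussKernel_le hh t

/-- The derivative is `-(t/h²) G_h(t)`, and `|x| exp(-x²/2) ≤ 1` because `|x| ≤ 1 + x²/2 ≤
exp(x²/2)`. This constant is the source of the `h⁻²` in the sampling error. -/
theorem abs_gaussKernel_sub_le {h : ℝ} (hh : 0 < h) (a b : ℝ) :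
    |gaussKernel h a - gaussKernel h b| ≤ 1 / h ^ 2 * |a - b| := by
  have hderiv : ∀ t, HasDerivAt (gaussKernel h)
      (1 / (Real.sqrt (2 * Real.pi) * h) * (Real.exp (-(t ^ 2) / (2 * h ^ 2)) * (-(t / h ^ 2)))) t := by
    intro t
    have h1 : HasDerivAt (fun t : ℝ => -(t ^ 2) / (2 * h ^ 2)) (-(t / h ^ 2)) t := by
      have := ((hasDerivAt_pow 2 t).neg).div_const (2 * h ^ 2)
      refine this.congr_deriv ?_
      field_simp
      norm_num
    exact h1.exp.const_mul _
  have hbound : ∀ t, ‖1 / (Real.sqrt (2 * Real.pi) * h) *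
      (Real.exp (-(t ^ 2) / (2 * h ^ 2)) * (-(t / h ^ 2)))‖ ≤ 1 / h ^ 2 := by
    intro t
    have h1 : |t / h| * Real.exp (-(t ^ 2) / (2 * h ^ 2)) ≤ 1 := by
      have h2 : |t / h| ≤ Real.exp (t ^ 2 / (2 * h ^ 2)) := by
        refine le_trans ?_ (Real.add_one_le_exp _)
        have : t ^ 2 / (2 * h ^ 2) = |t / h| ^ 2 / 2 := by rw [sq_abs]; field_simp
        rw [this]
        nlinarith [sq_nonneg (|t / h| - 1)]
      rw [neg_div, Real.exp_neg, ← div_eq_mul_inv]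
      exact (div_le_one (Real.exp_pos _)).2 h2
    have h3 : 1 / Real.sqrt (2 * Real.pi) ≤ 1 := by
      rw [div_le_one (by positivity)]
      exact one_le_sqrt_two_pi
    rw [Real.norm_eq_abs, abs_mul, abs_mul, abs_neg, Real.abs_exp, abs_of_nonneg (by positivity)]
    calc _ = 1 / h ^ 2 * (1 / Real.sqrt (2 * Real.pi)) *
          (|t / h| * Real.exp (-(t ^ 2) / (2 * h ^ 2))) := by
          rw [abs_div, abs_div, abs_of_pos hh, abs_of_pos (pow_pos hh 2)]
          field_simp
      _ ≤ 1 / h ^ 2 * 1 * 1 := by gcongr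
      _ = _ := by ring
  simpa using convex_univ.norm_image_sub_le_of_norm_hasDerivWithin_le
    (fun t _ => (hderiv t).hasDerivWithinAt) (fun t _ => hbound t) (Set.mem_univ b) (Set.mem_univ a)

theorem integrable_gaussKernel {h : ℝ} (hh : 0 < h) : Integrable (gaussKernel h) := by
  rw [funext (gaussKernel_eq_gaussianPDFReal hh)]
  exact integrable_gaussianPDFReal _ _

theorem integral_gaussKernel {h : ℝ} (hh : 0 < h) : ∫ t, gaussKernel h t = 1 := by
  rw [funext (gaussKernel_eq_gaussianPDFReal hh)]
  refine integral_gaussianPDFReal_eq_one _ ?_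
  rw [ne_eq, Real.toNNReal_eq_zero, not_le]
  positivity

theorem gaussKernel_mul_sq {h : ℝ} (hh : 0 < h) :
    Integrable (fun t => gaussKernel h t * t ^ 2) ∧ ∫ t, gaussKernel h t * t ^ 2 = h ^ 2 := by
  have hv : (h ^ 2).toNNReal ≠ 0 := by
    rw [ne_eq, Real.toNNReal_eq_zero, not_le]
    positivity
  have hint : ∫ t, gaussKernel h t * t ^ 2 = h ^ 2 := by
    have h1 := variance_fun_id_gaussianReal (μ := 0) (v := (h ^ 2).toNNReal)
    rw [variance_eq_integral (by fun_prop), integral_id_gaussianReal,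
      integral_gaussianReal_eq_integral_smul hv, Real.coe_toNNReal _ (by positivity)] at h1
    simpa [gaussKernel_eq_gaussianPDFReal hh] using h1
  refine ⟨?_, hint⟩
  -- A non-integrable function has Bochner integral `0`, whereas the integral is `h² > 0`.
  by_contra hni
  rw [integral_undef hni] at hint
  exact (pow_pos hh 2).ne hint

end GaussKernel

/-! ### Bounded densities and the smoothing bias -/

/-- `q` is a probability density on the line bounded by `M`. -/
structure IsBoundedDensity (q : ℝ → ℝ) (M : ℝ) : Prop where
  measurable : Measurable q
  nonneg : ∀ a, 0 ≤ q a
  le : ∀ a, q a ≤ M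
  integrable : Integrable q
  integral_eq : ∫ a, q a = 1

/-- The autocorrelation `∫ q(a) q(a - u) da`. -/
noncomputable def autocorr (q : ℝ → ℝ) (u : ℝ) : ℝ := ∫ a, q a * q (a - u)

/-- The smoothed information potential `∫∫ G_h(a - b) q(a) q(b) db da`. -/
noncomputable def smoothedPotential (h : ℝ) (q : ℝ → ℝ) : ℝ :=
  ∫ a, q a * ∫ b, gaussKernel h (a - b) * q b

namespace IsBoundedDensity

variable {q : ℝ → ℝ} {M : ℝ}

theorem abs_le (hq : IsBoundedDensity q M) (a : ℝ) : |q a| ≤ M := by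
  rw [abs_of_nonneg (hq.nonneg a)]
  exact hq.le a

theorem integrable_mul_translate (hq : IsBoundedDensity q M) (u : ℝ) : Integrable fun a => q a * q (a - u) :=
  (hq.integrable.comp_sub_right u).bdd_mul (c := M) hq.measurable.aestronglyMeasurable
    (Eventually.of_forall hq.abs_le)

theorem integrable_sq (hq : IsBoundedDensity q M) : Integrable fun a => q a ^ 2 := by
  simpa [sq] using hq.integrable_mul_translate 0

theorem autocorr_nonneg (hq : IsBoundedDensity q M) (u : ℝ) : 0 ≤ autocorr q u :=
  integral_nonneg fun a => mul_nonneg (hq.nonneg a) (hq.nonneg _)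

/-- By `xy ≤ (x² + y²)/2` and translation invariance, the autocorrelation is largest at the origin.
-/
theorem autocorr_le (hq : IsBoundedDensity q M) (u : ℝ) : autocorr q u ≤ ∫ a, q a ^ 2 := by
  have h1 : ∫ a, q (a - u) ^ 2 = ∫ a, q a ^ 2 := integral_sub_right_eq_self (fun a => q a ^ 2) u
  have h2 := hq.integrable_sq
  have h3 := h2.comp_sub_right u
  calc autocorr q u ≤ ∫ a, (1 / 2 * q a ^ 2 + 1 / 2 * q (a - u) ^ 2) := by
        refine integral_mono (hq.integrable_mul_translate u)
          ((h2.const_mul _).add (h3.const_mul _)) fun a => ?_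
        simp only
        nlinarith [sq_nonneg (q a - q (a - u))]
    _ = _ := by
        rw [integral_add (h2.const_mul _) (h3.const_mul _), integral_const_mul,
          integral_const_mul, h1]
        ring

theorem integral_sq_sub_autocorr (hq : IsBoundedDensity q M) (u : ℝ) :
    (∫ a, q a ^ 2) - autocorr q u = ∫ a, q a * (q a - q (a - u)) := by
  rw [autocorr, ← integral_sub hq.integrable_sq (hq.integrable_mul_translate u)]
  refine integral_congr_ae (Eventually.of_forall fun a => ?_)
  simp only
  ring

theorem measurable_autocorr (hq : IsBoundedDensity q M) : Measurable (autocorr q) := by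
  have hm : Measurable fun x : ℝ × ℝ => q x.2 * q (x.2 - x.1) :=
    (hq.measurable.comp measurable_snd).mul
      (hq.measurable.comp (measurable_snd.sub measurable_fst))
  exact (hm.stronglyMeasurable.integral_prod_right (ν := volume)).measurable

theorem integrable_gaussKernel_mul_autocorr (hq : IsBoundedDensity q M) {h : ℝ} (hh : 0 < h) :
    Integrable fun u => gaussKernel h u * autocorr q u := by
  refine ((integrable_gaussKernel hh).bdd_mul (c := ∫ a, q a ^ 2)
    hq.measurable_autocorr.aestronglyMeasurable (Eventually.of_forall fun u => ?_)).congr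
    (Eventually.of_forall fun u => mul_comm _ _)
  rw [Real.norm_eq_abs, abs_of_nonneg (hq.autocorr_nonneg u)]
  exact hq.autocorr_le u

/-- Substitute `u = a - b` and exchange the integrals; smoothing becomes a Gaussian average of the
autocorrelation. -/
theorem smoothedPotential_eq (hq : IsBoundedDensity q M) {h : ℝ} (hh : 0 < h) :
    smoothedPotential h q = ∫ u, gaussKernel h u * autocorr q u := by
  have hinner : ∀ a, q a * ∫ b, gaussKernel h (a - b) * q b =
      ∫ u, gaussKernel h u * (q a * q (a - u)) := fun a => by
    rw [← integral_sub_left_eq_self (fun b => gaussKernel h (a - b) * q b) volume a,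
      ← integral_const_mul]
    refine integral_congr_ae (Eventually.of_forall fun u => ?_)
    simp only [sub_sub_cancel]
    ring
  have hint : Integrable (Function.uncurry fun a u => gaussKernel h u * (q a * q (a - u)))
      (volume.prod volume) := by
    have h1 : Integrable (fun x : ℝ × ℝ => q x.1 * gaussKernel h x.2) (volume.prod volume) :=
      hq.integrable.mul_prod (integrable_gaussKernel hh)
    have hm : Measurable fun x : ℝ × ℝ => q (x.1 - x.2) :=
      hq.measurable.comp (measurable_fst.sub measurable_snd)
    refine (h1.bdd_mul (c := M) hm.aestronglyMeasurable
      (Eventually.of_forall fun x => hq.abs_le _)).congr (Eventually.of_forall fun x => ?_)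
    simp only [Function.uncurry]
    ring
  unfold smoothedPotential
  simp_rw [hinner]
  rw [integral_integral_swap hint]
  simp_rw [integral_const_mul]
  rfl

/-- The one-sided bias: being free of any modulus of continuity, it holds at a random,
data-dependent `f`. -/
theorem smoothedPotential_le (hq : IsBoundedDensity q M) {h : ℝ} (hh : 0 < h) :
    smoothedPotential h q ≤ ∫ a, q a ^ 2 := by
  rw [hq.smoothedPotential_eq hh]
  calc _ ≤ ∫ u, gaussKernel h u * ∫ a, q a ^ 2 :=
        integral_mono (hq.integrable_gaussKernel_mul_autocorr hh)
          ((integrable_gaussKernel hh).mul_const _) fun u =>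
            mul_le_mul_of_nonneg_left (hq.autocorr_le u) (gaussKernel_pos hh u).le
    _ = _ := by rw [integral_mul_const, integral_gaussKernel hh, one_mul]

/-- The smoothing bias is controlled by a quadratic modulus of the autocorrelation. -/
theorem integral_sq_sub_smoothedPotential_le (hq : IsBoundedDensity q M) {h : ℝ} (hh : 0 < h) {α β : ℝ}
    (hαβ : ∀ u, (∫ a, q a ^ 2) - autocorr q u ≤ α + β * u ^ 2) :
    (∫ a, q a ^ 2) - smoothedPotential h q ≤ α + β * h ^ 2 := by
  obtain ⟨hi2, h2⟩ := gaussKernel_mul_sq hh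
  have hi0 := integrable_gaussKernel hh
  rw [hq.smoothedPotential_eq hh]
  set V := ∫ a, q a ^ 2 with hV
  have h3 : (∫ u, gaussKernel h u * V) - ∫ u, gaussKernel h u * autocorr q u ≤
      ∫ u, (gaussKernel h u * α + β * (gaussKernel h u * u ^ 2)) := by
    rw [← integral_sub (hi0.mul_const _) (hq.integrable_gaussKernel_mul_autocorr hh)]
    refine integral_mono ((hi0.mul_const _).sub (hq.integrable_gaussKernel_mul_autocorr hh))
      ((hi0.mul_const _).add (hi2.const_mul _)) fun u => ?_
    have := mul_le_mul_of_nonneg_left (hαβ u) (gaussKernel_pos hh u).le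
    simp only
    linarith
  rw [integral_add (hi0.mul_const _) (hi2.const_mul _), integral_const_mul, integral_mul_const,
    integral_mul_const, integral_gaussKernel hh, h2] at h3
  linarith

/-- Translation is continuous in mean. -/
theorem tendsto_integral_abs_sub_translate (hq : IsBoundedDensity q M) :
    Tendsto (fun u => ∫ a, |q a - q (a - u)|) (𝓝 0) (𝓝 0) := by
  have hfact : Fact ((1 : ENNReal) ≠ ⊤) := ⟨ENNReal.one_ne_top⟩
  have hmem : MemLp q 1 volume := memLp_one_iff_integrable.2 hq.integrable
  -- Translations act continuously on `L¹`, so the norm of the difference is continuous in `u` and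
  -- vanishes at `0`.
  have hcont : Continuous fun u : ℝ => ‖hmem.toLp q - (DomAddAct.mk (-u) +ᵥ hmem.toLp q)‖ := by
    have : Continuous fun u : ℝ => DomAddAct.mk (-u) :=
      DomAddAct.continuous_mk.comp continuous_neg
    exact (continuous_const.sub (this.vadd continuous_const)).norm
  have heq : ∀ u : ℝ, ‖hmem.toLp q - (DomAddAct.mk (-u) +ᵥ hmem.toLp q)‖ =
      ∫ a, |q a - q (a - u)| := fun u => by
    rw [DomAddAct.mk_vadd_toLp, ← MemLp.toLp_sub]
    rw [L1.norm_eq_integral_norm]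
    refine integral_congr_ae ?_
    filter_upwards [MemLp.coeFn_toLp (hmem.sub (hmem.comp_measurePreserving
      (measurePreserving_vadd (-u) volume)))] with a ha
    refine (congrArg norm ha).trans ?_
    simp [vadd_eq_add, sub_eq_add_neg, add_comm]
  have h0 := hcont.tendsto 0
  simp_rw [heq] at h0
  simpa using h0

theorem integral_sq_sub_autocorr_le (hq : IsBoundedDensity q M) (u : ℝ) :
    (∫ a, q a ^ 2) - autocorr q u ≤ M * ∫ a, |q a - q (a - u)| := by
  have hi : Integrable fun a => q a - q (a - u) := hq.integrable.sub (hq.integrable.comp_sub_right u)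
  rw [hq.integral_sq_sub_autocorr, ← integral_const_mul]
  refine integral_mono (hi.bdd_mul (c := M) hq.measurable.aestronglyMeasurable
    (Eventually.of_forall hq.abs_le)) (hi.abs.const_mul _) fun a => ?_
  exact (mul_le_mul_of_nonneg_left (le_abs_self _) (hq.nonneg a)).trans
    (mul_le_mul_of_nonneg_right (hq.le a) (abs_nonneg _))

/-- For `|u| < δ` the defect of the autocorrelation is below `ε/2` by `L¹` continuity; otherwise it
is at most `V ≤ V u²/δ²`, `V` being `∫ q²`. The Gaussian variance turns the second bound into `V
h²/δ²`, which vanishes. -/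
theorem tendsto_smoothedPotential (hq : IsBoundedDensity q M) {h : ℕ → ℝ} (hpos : ∀ n, 0 < n → 0 < h n)
    (hlim : Tendsto h atTop (𝓝 0)) :
    Tendsto (fun n => (∫ a, q a ^ 2) - smoothedPotential (h n) q) atTop (𝓝 0) := by
  have hV : 0 ≤ ∫ a, q a ^ 2 := integral_nonneg fun a => sq_nonneg _
  rw [Metric.tendsto_atTop]
  intro ε hε
  have hmod := (hq.tendsto_integral_abs_sub_translate.const_mul M)
  rw [mul_zero] at hmod
  obtain ⟨δ, hδ, hball⟩ := Metric.eventually_nhds_iff.1 (hmod.eventually_lt_const (half_pos hε))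
  have hquad : ∀ u, (∫ a, q a ^ 2) - autocorr q u ≤ ε / 2 + (∫ a, q a ^ 2) / δ ^ 2 * u ^ 2 := by
    intro u
    have hnn : 0 ≤ (∫ a, q a ^ 2) / δ ^ 2 * u ^ 2 := by positivity
    by_cases hu : |u| < δ
    · have := hball (y := u) (by simpa using hu)
      linarith [hq.integral_sq_sub_autocorr_le u]
    · have h1 : δ ^ 2 ≤ u ^ 2 := by
        rw [← sq_abs u]; exact pow_le_pow_left₀ hδ.le (not_lt.1 hu) 2
      have h2 : ∫ a, q a ^ 2 ≤ (∫ a, q a ^ 2) / δ ^ 2 * u ^ 2 := by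
        rw [div_mul_eq_mul_div, le_div_iff₀ (by positivity)]
        exact mul_le_mul_of_nonneg_left h1 hV
      linarith [hq.autocorr_nonneg u]
  have hh2 : Tendsto (fun n => (∫ a, q a ^ 2) / δ ^ 2 * h n ^ 2) atTop (𝓝 0) := by
    simpa using (hlim.pow 2).const_mul ((∫ a, q a ^ 2) / δ ^ 2)
  obtain ⟨N, hN⟩ := eventually_atTop.1 (hh2.eventually_lt_const (half_pos hε))
  refine ⟨N + 1, fun n hn => ?_⟩
  have hhn := hpos n (by omega)
  have h1 := hq.integral_sq_sub_smoothedPotential_le hhn hquad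
  have h2 := hq.smoothedPotential_le hhn
  have h3 := hN n (by omega)
  rw [Real.dist_eq, sub_zero, abs_of_nonneg (by linarith)]
  linarith

theorem integral_sq_sub_smoothedPotential_le_of_lipschitz (hq : IsBoundedDensity q M) {L : ℝ}
    (hL : ∀ a b, |q a - q b| ≤ L * |a - b|) {h : ℝ} (hh : 0 < h) :
    (∫ a, q a ^ 2) - smoothedPotential h q ≤ L * h := by
  have hL0 : 0 ≤ L := by simpa using (abs_nonneg _).trans (hL 1 0)
  have h1 : ∀ u, (∫ a, q a ^ 2) - autocorr q u ≤ L * |u| := fun u => by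
    have hi : Integrable fun a => q a - q (a - u) :=
      hq.integrable.sub (hq.integrable.comp_sub_right u)
    rw [hq.integral_sq_sub_autocorr]
    calc _ ≤ ∫ a, q a * (L * |u|) := by
          refine integral_mono (hi.bdd_mul (c := M) hq.measurable.aestronglyMeasurable
            (Eventually.of_forall hq.abs_le)) (hq.integrable.mul_const _) fun a => ?_
          refine mul_le_mul_of_nonneg_left ((le_abs_self _).trans ((hL _ _).trans_eq ?_))
            (hq.nonneg a)
          rw [sub_sub_cancel]
      _ = _ := by rw [integral_mul_const, hq.integral_eq, one_mul]
  -- Young's inequality `L|u| ≤ Lh/2 + L u²/(2h)`, with equality at `|u| = h`, replaces the first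
  -- absolute moment by the variance.
  refine (hq.integral_sq_sub_smoothedPotential_le hh (α := L * h / 2) (β := L / (2 * h))
    fun u => (h1 u).trans ?_).trans_eq ?_
  · have : L * h / 2 + L / (2 * h) * u ^ 2 - L * |u| = L / (2 * h) * (|u| - h) ^ 2 := by
      rw [← sq_abs u]; field_simp; ring
    have h2 : 0 ≤ L / (2 * h) * (|u| - h) ^ 2 := by positivity
    linarith
  · field_simp; ring

/-- A density with mass at least `1/2` on `[-R, R]` has `∫ q² ≥ 1 / (8R)`. -/
theorem le_integral_sq (hq : IsBoundedDensity q M) {R : ℝ} (hR : 0 < R) (hmass : 1 / 2 ≤ ∫ a in Set.Icc (-R) R, q a) :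
    1 / (8 * R) ≤ ∫ a, q a ^ 2 := by
  have hc : IntegrableOn (fun _ : ℝ => (1 / (4 * R)) ^ 2) (Set.Icc (-R) R) :=
    integrableOn_const measure_Icc_lt_top.ne
  have hi : IntegrableOn (fun a => 2 * (1 / (4 * R)) * q a) (Set.Icc (-R) R) :=
    (hq.integrable.const_mul _).integrableOn
  -- Integrate `q² ≥ 2tq - t²` over `[-R, R]`; `t = 1/(4R)` maximizes the resulting bound `t - 2R
  -- t²`.
  calc 1 / (8 * R) = 2 * (1 / (4 * R)) * (1 / 2) - (1 / (4 * R)) ^ 2 * (2 * R) := by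
        field_simp; norm_num
    _ ≤ 2 * (1 / (4 * R)) * (∫ a in Set.Icc (-R) R, q a) - (1 / (4 * R)) ^ 2 * (2 * R) := by gcongr
    _ = ∫ a in Set.Icc (-R) R, (2 * (1 / (4 * R)) * q a - (1 / (4 * R)) ^ 2) := by
        rw [integral_sub hi hc, integral_const_mul, setIntegral_const]
        simp [Measure.real, hR.le]
        ring_nf
    _ ≤ ∫ a in Set.Icc (-R) R, q a ^ 2 := by
        refine setIntegral_mono (hi.sub hc) hq.integrable_sq.integrableOn fun a => ?_
        simp only
        nlinarith [sq_nonneg (q a - 1 / (4 * R))]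
    _ ≤ ∫ a, q a ^ 2 :=
        setIntegral_le_integral hq.integrable_sq (Eventually.of_forall fun a => sq_nonneg _)

end IsBoundedDensity

/-! ### Error densities in the regression model -/

section Model

variable [MeasurableSpace 𝒳]

/-- The density of the error of `f` in a regression model: the mixture of the translated noise
densities. -/
noncomputable def mixtureDensity (ρ : Measure (𝒳 × ℝ)) (fstar : 𝒳 → ℝ) (p : 𝒳 → ℝ → ℝ)
    (f : 𝒳 → ℝ) (e : ℝ) : ℝ :=
  ∫ x, p x (e + (f x - fstar x)) ∂ρ.fst

variable {ρ : Measure (𝒳 × ℝ)} {fstar : 𝒳 → ℝ} {p : 𝒳 → ℝ → ℝ}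

theorem mixtureDensity_nonneg (hm : IsRegressionModel ρ fstar p) (f : 𝒳 → ℝ) (e : ℝ) :
    0 ≤ mixtureDensity ρ fstar p f e :=
  integral_nonneg fun _ => hm.density_nonneg _ _

theorem measurable_translated_density (hm : IsRegressionModel ρ fstar p) {f : 𝒳 → ℝ}
    (hf : Measurable f) : Measurable fun q : 𝒳 × ℝ => p q.1 (q.2 + (f q.1 - fstar q.1)) := by
  have h1 := hm.measurable_fstar
  exact hm.measurable_density.comp (measurable_fst.prodMk (measurable_snd.add
    ((hf.comp measurable_fst).sub (h1.comp measurable_fst))))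

variable [IsProbabilityMeasure ρ]

theorem measurable_mixtureDensity (hm : IsRegressionModel ρ fstar p) {f : 𝒳 → ℝ}
    (hf : Measurable f) : Measurable (mixtureDensity ρ fstar p f) :=
  ((measurable_translated_density hm hf).stronglyMeasurable.integral_prod_left
    (μ := ρ.fst)).measurable

theorem integrable_translated_density (hm : IsRegressionModel ρ fstar p) {M : ℝ}
    (hM : ∀ x t, p x t ≤ M) {f : 𝒳 → ℝ} (hf : Measurable f) (e : ℝ) :
    Integrable (fun x => p x (e + (f x - fstar x))) ρ.fst :=
  integrable_of_abs_le (B := M)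
    ((measurable_translated_density hm hf).comp (measurable_id.prodMk measurable_const)) fun x => by
      rw [abs_of_nonneg (hm.density_nonneg _ _)]
      exact hM _ _

theorem ofReal_mixtureDensity (hm : IsRegressionModel ρ fstar p) {M : ℝ}
    (hM : ∀ x t, p x t ≤ M) {f : 𝒳 → ℝ} (hf : Measurable f) (e : ℝ) :
    ENNReal.ofReal (mixtureDensity ρ fstar p f e) =
      ∫⁻ x, ENNReal.ofReal (p x (e + (f x - fstar x))) ∂ρ.fst :=
  ofReal_integral_eq_lintegral_ofReal (integrable_translated_density hm hM hf e)
    (Eventually.of_forall fun _ => hm.density_nonneg _ _)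

/-- The law of the error of `f`. -/
theorem map_err_eq_withDensity (hm : IsRegressionModel ρ fstar p) {M : ℝ}
    (hM : ∀ x t, p x t ≤ M) {f : 𝒳 → ℝ} (hf : Measurable f) :
    ρ.map (err f) =
      volume.withDensity fun e => ENNReal.ofReal (mixtureDensity ρ fstar p f e) := by
  have hfs := hm.measurable_fstar
  set T : 𝒳 × ℝ → ℝ := fun q => q.2 - (f q.1 - fstar q.1) with hT
  have hTm : Measurable T := measurable_snd.sub ((hf.comp measurable_fst).sub
    (hfs.comp measurable_fst))
  have hpair : Measurable fun z : 𝒳 × ℝ => (z.1, err fstar z) :=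
    measurable_fst.prodMk (measurable_err hfs)
  -- The error of `f` is the noise minus `f - f*`, so its law is read off from the joint law of
  -- input and noise.
  have hcomp : err f = T ∘ fun z : 𝒳 × ℝ => (z.1, err fstar z) := by
    funext z
    simp only [hT, err, Function.comp]
    ring
  have hpm : Measurable fun q : 𝒳 × ℝ => ENNReal.ofReal (p q.1 q.2) :=
    hm.measurable_density.ennreal_ofReal
  have hpm' := (measurable_translated_density hm hf).ennreal_ofReal
  rw [hcomp, ← Measure.map_map hTm hpair, hm.law_noise]
  ext s hs
  rw [Measure.map_apply hTm hs, withDensity_apply _ (hTm hs), withDensity_apply _ hs,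
    ← lintegral_indicator (hTm hs), lintegral_prod _ (hpm.indicator (hTm hs)).aemeasurable]
  simp_rw [ofReal_mixtureDensity hm hM hf]
  have hswap : ∫⁻ e in s, (∫⁻ x, ENNReal.ofReal (p x (e + (f x - fstar x))) ∂ρ.fst) =
      ∫⁻ x, (∫⁻ e in s, ENNReal.ofReal (p x (e + (f x - fstar x)))) ∂ρ.fst :=
    lintegral_lintegral_swap (by exact (hpm'.comp measurable_swap).aemeasurable)
  rw [hswap]
  refine lintegral_congr fun x => ?_
  rw [← lintegral_add_right_eq_self _ (f x - fstar x), ← lintegral_indicator hs]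
  refine lintegral_congr fun e => ?_
  by_cases he : e ∈ s
  · rw [Set.indicator_of_mem he, Set.indicator_of_mem (by simpa [hT] using he)]
  · rw [Set.indicator_of_notMem he, Set.indicator_of_notMem (by simpa [hT] using he)]

theorem isBoundedDensity_mixtureDensity (hm : IsRegressionModel ρ fstar p) {M : ℝ}
    (hM : ∀ x t, p x t ≤ M) {f : 𝒳 → ℝ} (hf : Measurable f) :
    IsBoundedDensity (mixtureDensity ρ fstar p f) M := by
  have hmeas := measurable_mixtureDensity hm hf
  have hnn := mixtureDensity_nonneg hm f
  have hone : ∫⁻ e, ENNReal.ofReal (mixtureDensity ρ fstar p f e) = 1 := by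
    rw [← setLIntegral_univ, ← withDensity_apply _ MeasurableSet.univ,
      ← map_err_eq_withDensity hm hM hf, Measure.map_apply (measurable_err hf) MeasurableSet.univ,
      Set.preimage_univ, measure_univ]
  refine ⟨hmeas, hnn, fun e => ?_, ?_, ?_⟩
  · calc mixtureDensity ρ fstar p f e ≤ ∫ _x, M ∂ρ.fst :=
          integral_mono (integrable_translated_density hm hM hf e) (integrable_const _)
            fun x => hM _ _
      _ = M := by simp
  · refine (lintegral_ofReal_ne_top_iff_integrable hmeas.aestronglyMeasurable
      (Eventually.of_forall hnn)).1 ?_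
    rw [hone]
    exact ENNReal.one_ne_top
  · rw [integral_eq_lintegral_of_nonneg_ae (Eventually.of_forall hnn) hmeas.aestronglyMeasurable,
      hone, ENNReal.toReal_one]

/-- The Radon–Nikodym density and the mixture agree almost everywhere, which suffices under the
integral. -/
theorem integral_errorDensity_sq (hm : IsRegressionModel ρ fstar p) {M : ℝ}
    (hM : ∀ x t, p x t ≤ M) {f : 𝒳 → ℝ} (hf : Measurable f) :
    ∫ e, errorDensity ρ f e ^ 2 = ∫ e, mixtureDensity ρ fstar p f e ^ 2 := by
  have hpdf : pdf (err f) ρ volume =ᵐ[volume]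
      fun e => ENNReal.ofReal (mixtureDensity ρ fstar p f e) := by
    rw [pdf_def, map_err_eq_withDensity hm hM hf]
    exact Measure.rnDeriv_withDensity _ (measurable_mixtureDensity hm hf).ennreal_ofReal
  refine integral_congr_ae ?_
  filter_upwards [hpdf] with e he
  rw [errorDensity, he, ENNReal.toReal_ofReal (mixtureDensity_nonneg hm f e)]

theorem renyiEntropy_eq (hm : IsRegressionModel ρ fstar p) {M : ℝ}
    (hM : ∀ x t, p x t ≤ M) {f : 𝒳 → ℝ} (hf : Measurable f) :
    renyiEntropy ρ f = -Real.log (∫ e, mixtureDensity ρ fstar p f e ^ 2) := by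
  rw [renyiEntropy, integral_errorDensity_sq hm hM hf]

theorem integral_comp_err (hm : IsRegressionModel ρ fstar p) {M : ℝ}
    (hM : ∀ x t, p x t ≤ M) {f : 𝒳 → ℝ} (hf : Measurable f) {φ : ℝ → ℝ} (hφ : Measurable φ) :
    ∫ z, φ (err f z) ∂ρ = ∫ e, φ e * mixtureDensity ρ fstar p f e := by
  rw [← integral_map (measurable_err hf).aemeasurable (f := φ) hφ.aestronglyMeasurable,
    map_err_eq_withDensity hm hM hf,
    integral_withDensity_eq_integral_toReal_smul
      (measurable_mixtureDensity hm hf).ennreal_ofReal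
      (Eventually.of_forall fun _ => ENNReal.ofReal_lt_top)]
  refine integral_congr_ae (Eventually.of_forall fun e => ?_)
  simp only
  rw [ENNReal.toReal_ofReal (mixtureDensity_nonneg hm f e), smul_eq_mul, mul_comm]

theorem integral_integral_gaussKernel_err (hm : IsRegressionModel ρ fstar p) {M : ℝ}
    (hM : ∀ x t, p x t ≤ M) {f : 𝒳 → ℝ} (hf : Measurable f) (h : ℝ) :
    ∫ u, ∫ v, gaussKernel h (err f u - err f v) ∂ρ ∂ρ =
      smoothedPotential h (mixtureDensity ρ fstar p f) := by
  have hg : Measurable (gaussKernel h) := (continuous_gaussKernel h).measurable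
  have hinner : ∀ a, ∫ v, gaussKernel h (a - err f v) ∂ρ =
      ∫ e, gaussKernel h (a - e) * mixtureDensity ρ fstar p f e := fun a =>
    integral_comp_err hm hM hf (φ := fun e => gaussKernel h (a - e))
      (hg.comp (measurable_const.sub measurable_id))
  simp_rw [hinner]
  have hmeas : Measurable fun a => ∫ e, gaussKernel h (a - e) * mixtureDensity ρ fstar p f e := by
    have : Measurable fun q : ℝ × ℝ =>
        gaussKernel h (q.1 - q.2) * mixtureDensity ρ fstar p f q.2 :=
      (hg.comp (measurable_fst.sub measurable_snd)).mul
        ((measurable_mixtureDensity hm hf).comp measurable_snd)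
    exact (this.stronglyMeasurable.integral_prod_right (ν := volume)).measurable
  rw [integral_comp_err hm hM hf hmeas, smoothedPotential]
  simp_rw [mul_comm (mixtureDensity ρ fstar p f _) (∫ _, _)]

theorem integral_pi_pair {Z : Type*} [MeasurableSpace Z] (μ : Measure Z) [IsProbabilityMeasure μ]
    {n : ℕ} {i j : Fin n} (hij : i ≠ j) {k : Z → Z → ℝ} (hk : Measurable (Function.uncurry k))
    {B : ℝ} (hB : ∀ u v, |k u v| ≤ B) :
    ∫ z, k (z i) (z j) ∂(Measure.pi fun _ => μ) = ∫ u, ∫ v, k u v ∂μ ∂μ := by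
  have hind : IndepFun (fun z : Fin n → Z => z i) (fun z => z j) (Measure.pi fun _ => μ) :=
    (iIndepFun_pi (μ := fun _ : Fin n => μ) (X := fun _ => id)
      fun _ => aemeasurable_id).indepFun hij
  have hmap := (indepFun_iff_map_prod_eq_prod_map_map (measurable_pi_apply i).aemeasurable
    (measurable_pi_apply j).aemeasurable).1 hind
  rw [(measurePreserving_eval (fun _ : Fin n => μ) i).map_eq,
    (measurePreserving_eval (fun _ : Fin n => μ) j).map_eq] at hmap
  have hint : Integrable (Function.uncurry k) (μ.prod μ) :=
    integrable_of_abs_le hk fun q => hB q.1 q.2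
  refine Eq.trans ?_ (integral_prod _ hint)
  rw [← hmap, integral_map
    ((measurable_pi_apply i).prodMk (measurable_pi_apply j)).aemeasurable hk.aestronglyMeasurable]
  rfl

/-- The mean of the empirical information potential differs from the smoothed potential only by
the contribution of the diagonal. -/
theorem abs_integral_pairMean_sub_le (hm : IsRegressionModel ρ fstar p) {M : ℝ}
    (hM : ∀ x t, p x t ≤ M) {f : 𝒳 → ℝ} (hf : Measurable f) {h : ℝ} (hh : 0 < h) {n : ℕ}
    (hn : 0 < n) :
    |∫ z, pairMean (gaussKernel h) f z ∂(sampleLaw ρ n) -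
      smoothedPotential h (mixtureDensity ρ fstar p f)| ≤ 1 / (n * h) := by
  have hn' : (0 : ℝ) < n := by exact_mod_cast hn
  set S := smoothedPotential h (mixtureDensity ρ fstar p f) with hS
  have hkm : Measurable (Function.uncurry fun u v => gaussKernel h (err f u - err f v)) :=
    (continuous_gaussKernel h).measurable.comp (((measurable_err hf).comp measurable_fst).sub
      ((measurable_err hf).comp measurable_snd))
  have hval : ∀ i j : Fin n, ∫ z, gaussKernel h (err f (z i) - err f (z j)) ∂(sampleLaw ρ n) =
      if i = j then gaussKernel h 0 else S := fun i j => by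
    have hprob : IsProbabilityMeasure (sampleLaw ρ n) := by unfold sampleLaw; infer_instance
    split_ifs with hij
    · subst hij
      simp
    · rw [hS, ← integral_integral_gaussKernel_err hm hM hf h]
      exact integral_pi_pair ρ hij (k := fun u v => gaussKernel h (err f u - err f v)) hkm
        fun u v => abs_gaussKernel_le hh _
  have hint : ∀ i j : Fin n, Integrable
      (fun z : Fin n → 𝒳 × ℝ => gaussKernel h (err f (z i) - err f (z j))) (sampleLaw ρ n) :=
    fun i j => by
      have hprob : IsProbabilityMeasure (sampleLaw ρ n) := by unfold sampleLaw; infer_instance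
      refine integrable_of_abs_le ?_ fun z => abs_gaussKernel_le hh _
      exact hkm.comp (g := Function.uncurry fun u v => gaussKernel h (err f u - err f v))
        (f := fun z : Fin n → 𝒳 × ℝ => (z i, z j))
        ((measurable_pi_apply i).prodMk (measurable_pi_apply j))
  -- The `n` diagonal terms equal `G_h(0)` and the other `n² - n` have mean `S`; both values lie in
  -- `[0, 1/h]`.
  have hmean : ∫ z, pairMean (gaussKernel h) f z ∂(sampleLaw ρ n) - S =
      (gaussKernel h 0 - S) / n := by
    unfold pairMean
    rw [integral_const_mul, integral_finsetSum _ fun i _ => integrable_finsetSum _ fun j _ =>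
      hint i j]
    simp_rw [integral_finsetSum _ fun j _ => hint _ j, hval]
    have : ∀ i j : Fin n, (if i = j then gaussKernel h 0 else S) =
        S + if i = j then gaussKernel h 0 - S else 0 := fun i j => by split_ifs <;> ring
    simp_rw [this, Finset.sum_add_distrib]
    simp
    field_simp
    ring
  have hS0 : 0 ≤ S := by
    rw [hS, ← integral_integral_gaussKernel_err hm hM hf h]
    exact integral_nonneg fun u => integral_nonneg fun v => (gaussKernel_pos hh _).le
  have hS1 : S ≤ 1 / h := by
    rw [hS, ← integral_integral_gaussKernel_err hm hM hf h]
    have hin : ∀ u, ‖∫ v, gaussKernel h (err f u - err f v) ∂ρ‖ ≤ 1 / h := fun u => by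
      simpa using norm_integral_le_of_norm_le_const (μ := ρ)
        (f := fun v => gaussKernel h (err f u - err f v))
        (Eventually.of_forall fun v => abs_gaussKernel_le hh _)
    refine (le_abs_self _).trans ?_
    simpa using norm_integral_le_of_norm_le_const (μ := ρ)
      (f := fun u => ∫ v, gaussKernel h (err f u - err f v) ∂ρ) (Eventually.of_forall hin)
  rw [hmean, abs_div, abs_of_pos hn', mul_comm, ← div_div]
  refine div_le_div_of_nonneg_right ?_ hn'.le
  rw [abs_le]
  constructor <;> linarith [gaussKernel_le hh 0, (gaussKernel_pos hh 0)]

/-- A uniform lower bound for the information potential over bounded perturbations of the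
regression function. -/
theorem exists_pos_le_integral_sq (hm : IsRegressionModel ρ fstar p) {M : ℝ}
    (hM : ∀ x t, p x t ≤ M) {D : ℝ} (hD : 0 ≤ D) :
    ∃ v : ℝ, 0 < v ∧ ∀ f : 𝒳 → ℝ, Measurable f → (∀ x, |f x - fstar x| ≤ D) →
      v ≤ ∫ e, mixtureDensity ρ fstar p f e ^ 2 := by
  have hes := measurable_err hm.measurable_fstar
  obtain ⟨N, hN⟩ : ∃ N : ℕ, 1 / 2 ≤ ρ.real {z | |err fstar z| ≤ N} := by
    have hmono : Monotone fun N : ℕ => {z : 𝒳 × ℝ | |err fstar z| ≤ N} := fun a b hab z hz =>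
      le_trans (show |err fstar z| ≤ a from hz) (by exact_mod_cast hab)
    have hlim := tendsto_measure_iUnion_atTop (μ := ρ) hmono
    have huniv : ⋃ N : ℕ, {z : 𝒳 × ℝ | |err fstar z| ≤ N} = Set.univ := by
      ext z
      simpa using exists_nat_ge |err fstar z|
    rw [huniv, measure_univ] at hlim
    have hlim' := (ENNReal.tendsto_toReal ENNReal.one_ne_top).comp hlim
    obtain ⟨N, hN⟩ := (hlim'.eventually_const_lt (u := 1 / 2) (by norm_num)).exists
    exact ⟨N, hN.le⟩
  -- Noise within `N` and perturbation within `D` keep the error in this interval with probability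
  -- at least `1/2`; the extra `1` keeps the radius positive.
  have hR : (0 : ℝ) < N + D + 1 := by positivity
  refine ⟨1 / (8 * (N + D + 1)), by positivity, fun f hf hfD => ?_⟩
  have hq := isBoundedDensity_mixtureDensity hm hM hf
  refine hq.le_integral_sq hR (hN.trans ?_)
  have h1 : ENNReal.ofReal (∫ a in Set.Icc (-(N + D + 1)) (N + D + 1), mixtureDensity ρ fstar p f a) =
      ρ (err f ⁻¹' Set.Icc (-(N + D + 1)) (N + D + 1)) := by
    rw [← Measure.map_apply (measurable_err hf) measurableSet_Icc, map_err_eq_withDensity hm hM hf,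
      withDensity_apply _ measurableSet_Icc]
    exact ofReal_integral_eq_lintegral_ofReal hq.integrable.integrableOn
      (Eventually.of_forall hq.nonneg)
  have h2 : ρ.real (err f ⁻¹' Set.Icc (-(N + D + 1)) (N + D + 1)) =
      ∫ a in Set.Icc (-(N + D + 1)) (N + D + 1), mixtureDensity ρ fstar p f a := by
    rw [Measure.real, ← h1, ENNReal.toReal_ofReal (integral_nonneg hq.nonneg)]
  rw [← h2]
  refine measureReal_mono fun z hz => ?_
  have h3 := abs_le.1 (show |err fstar z| ≤ N from hz)
  have h4 := abs_le.1 (hfD z.1)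
  simp only [err, Set.mem_preimage, Set.mem_Icc] at *
  constructor <;> linarith

/-- Each noise density is `M'`-Lipschitz by the mean value inequality, and averaging translates
preserves the constant for any measurable `f`. -/
theorem abs_mixtureDensity_sub_le (hm : IsRegressionModel ρ fstar p) {M : ℝ}
    (hM : ∀ x t, p x t ≤ M) {M' : ℝ}
    (hM' : ∀ x t, DifferentiableAt ℝ (p x) t ∧ |deriv (p x) t| ≤ M') {f : 𝒳 → ℝ}
    (hf : Measurable f) (a b : ℝ) :
    |mixtureDensity ρ fstar p f a - mixtureDensity ρ fstar p f b| ≤ M' * |a - b| := by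
  have hlip : ∀ x s t, |p x s - p x t| ≤ M' * |s - t| := fun x s t =>
    convex_univ.norm_image_sub_le_of_norm_deriv_le (fun u _ => (hM' x u).1)
      (fun u _ => (hM' x u).2) (Set.mem_univ t) (Set.mem_univ s)
  rw [mixtureDensity, mixtureDensity, ← integral_sub (integrable_translated_density hm hM hf a)
    (integrable_translated_density hm hM hf b)]
  have h1 : ∀ x, ‖p x (a + (f x - fstar x)) - p x (b + (f x - fstar x))‖ ≤ M' * |a - b| :=
    fun x => (hlip x _ _).trans_eq (by rw [add_sub_add_right_eq_sub])
  simpa using norm_integral_le_of_norm_le_const (μ := ρ.fst) (Eventually.of_forall h1)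

end Model

/-! ### Excess entropy of empirical minimizers -/

theorem empiricalEntropy_eq {n : ℕ} (h : ℝ) (z : Fin n → 𝒳 × ℝ) (f : 𝒳 → ℝ) :
    empiricalEntropy h z f = -Real.log (pairMean (gaussKernel h) f z) := by
  unfold empiricalEntropy pairMean kernelDensity
  rw [← Finset.mul_sum, ← mul_assoc]
  congr 3
  ring

theorem pairMean_gaussKernel_pos {n : ℕ} (hn : 0 < n) {h : ℝ} (hh : 0 < h) (z : Fin n → 𝒳 × ℝ)
    (f : 𝒳 → ℝ) : 0 < pairMean (gaussKernel h) f z := by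
  have : Nonempty (Fin n) := ⟨⟨0, hn⟩⟩
  have hn' : (0 : ℝ) < n := by exact_mod_cast hn
  refine mul_pos (by positivity) ?_
  exact Finset.sum_pos (fun i _ => Finset.sum_pos (fun j _ => gaussKernel_pos hh _)
    Finset.univ_nonempty) Finset.univ_nonempty

theorem minRenyiEntropy_eq [MeasurableSpace 𝒳] {ρ : Measure (𝒳 × ℝ)} {g : 𝒳 → ℝ}
    (hg : IsEntropyMinimizer ρ g) : minRenyiEntropy ρ = renyiEntropy ρ g := by
  refine IsLeast.csInf_eq ⟨⟨g, hg.1, rfl⟩, ?_⟩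
  rintro _ ⟨f, hf, rfl⟩
  exact hg.2 f hf

/-- The excess entropy of an empirical minimizer is controlled by the uniform deviation, the bias
of the smoothing, and the diagonal terms. -/
theorem exists_sampleLaw_excess_le [MetricSpace 𝒳] [MeasurableSpace 𝒳] [BorelSpace 𝒳]
    {ρ : Measure (𝒳 × ℝ)} [IsProbabilityMeasure ρ]
    (hsep : ∃ S : Set 𝒳, TopologicalSpace.IsSeparable S ∧ ∀ᵐ x ∂ρ.fst, x ∈ S)
    {fstar : 𝒳 → ℝ} {p : 𝒳 → ℝ → ℝ} (hm : IsRegressionModel ρ fstar p) {Mp : ℝ}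
    (hMp : ∀ x t, p x t ≤ Mp) {H : Set (𝒳 → ℝ)} (hH : IsAdmissibleSpace ρ fstar H)
    {g : 𝒳 → ℝ} (hgH : g ∈ H) (hg : IsEntropyMinimizer ρ g) :
    ∃ v K : ℝ, 0 < v ∧ 0 ≤ K ∧ ∀ (h : ℕ → ℝ) (fz : (n : ℕ) → (Fin n → 𝒳 × ℝ) → 𝒳 → ℝ),
      IsEmpiricalMEE ρ H h fz → ∀ n : ℕ, 0 < n → 0 < h n → ∀ η τ b : ℝ, 0 ≤ η → 0 ≤ τ →
      (∫ e, mixtureDensity ρ fstar p g e ^ 2) -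
        smoothedPotential (h n) (mixtureDensity ρ fstar p g) ≤ b →
      K / (h n ^ 2 * Real.sqrt n) + τ + 2 / (n * h n) + b ≤ v * η →
      sampleLaw ρ n {z | η < renyiEntropy ρ (fz n z) - minRenyiEntropy ρ} ≤
        ENNReal.ofReal (Real.exp (-(τ ^ 2 * (n * h n ^ 2)) / 32)) := by
  obtain ⟨D₀, hD₀⟩ := hH.bounded
  obtain ⟨c, s, hc, -, hs2, hent⟩ := hH.entropy_bound
  set D := |D₀| + 1 with hDdef
  have hD : 0 < D := by positivity
  have hHD : ∀ f ∈ H, ∀ x, |f x| ≤ D := fun f hf x => by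
    linarith [hD₀ f hf x, le_abs_self D₀]
  obtain ⟨v, hv, hvV⟩ := exists_pos_le_integral_sq hm hMp (D := D + D) (by positivity)
  have hlow : ∀ f ∈ H, v ≤ ∫ e, mixtureDensity ρ fstar p f e ^ 2 := fun f hf =>
    hvV f (hH.continuous f hf).measurable fun x =>
      (abs_sub _ _).trans (add_le_add (hHD f hf x) (hHD fstar hH.fstar_mem x))
  refine ⟨v, 16 * |chainingConst c s D|, hv, by positivity, ?_⟩
  intro h fz hfz n hn hh η τ b hη hτ hb hle
  have hn' : (0 : ℝ) < n := by exact_mod_cast hn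
  set k := gaussKernel (h n) with hk
  have hdev := sampleLaw_exists_mem_le ρ hsep (continuous_gaussKernel (h n)) (B := 1 / h n)
    (L := 1 / h n ^ 2) (by positivity) (abs_gaussKernel_le hh) (by positivity)
    (abs_gaussKernel_sub_le hh) hc.le hs2 hD hH.continuous hHD hent hgH hn hτ
  have hexp : -(τ ^ 2 * (n : ℝ)) / (32 * (1 / h n) ^ 2) = -(τ ^ 2 * (n * h n ^ 2)) / 32 := by
    field_simp
  rw [hexp] at hdev
  refine le_trans (measure_mono_ae ?_) hdev
  filter_upwards [hfz n hn] with z hz hηz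
  obtain ⟨hfH, hfmin⟩ := hz
  refine ⟨fz n z, hfH, ?_⟩
  set f := fz n z with hf
  have hfm : Measurable f := (hH.continuous f hfH).measurable
  have hgm : Measurable g := hg.1
  have hqf := isBoundedDensity_mixtureDensity hm hMp hfm
  have hVf := hlow f hfH
  have hVg := hlow g hgH
  set Vf := ∫ e, mixtureDensity ρ fstar p f e ^ 2 with hVfdef
  set Vg := ∫ e, mixtureDensity ρ fstar p g e ^ 2 with hVgdef
  have hVf0 : 0 < Vf := hv.trans_le hVf
  have hVg0 : 0 < Vg := hv.trans_le hVg
  have hpot : v * η < Vg - Vf := by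
    have h1 : η < renyiEntropy ρ f - minRenyiEntropy ρ := hηz
    rw [minRenyiEntropy_eq hg, renyiEntropy_eq hm hMp hfm, renyiEntropy_eq hm hMp hgm] at h1
    -- From `log x ≤ x - 1`; dividing by `Vf ≥ v` is where the uniform lower bound enters.
    have h2 : Real.log Vg - Real.log Vf ≤ (Vg - Vf) / Vf := by
      rw [← Real.log_div hVg0.ne' hVf0.ne', sub_div, div_self hVf0.ne']
      exact Real.log_le_sub_one_of_pos (by positivity)
    have h3 : η < (Vg - Vf) / Vf := by linarith
    rw [lt_div_iff₀ hVf0] at h3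
    nlinarith
  have hmin : pairMean k g z ≤ pairMean k f z := by
    have h1 := hfmin g hgH
    rw [empiricalEntropy_eq, empiricalEntropy_eq, neg_le_neg_iff] at h1
    exact (Real.log_le_log_iff (pairMean_gaussKernel_pos hn hh z g)
      (pairMean_gaussKernel_pos hn hh z f)).1 h1
  have hEf := abs_le.1 (abs_integral_pairMean_sub_le hm hMp hfm hh hn)
  have hEg := abs_le.1 (abs_integral_pairMean_sub_le hm hMp hgm hh hn)
  -- `Vg ≤ S(g) + b` and `S(f) ≤ Vf` give `Vg - Vf ≤ b + S(g) - S(f)`. Replacing `S` by expected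
  -- pair means costs `2/(n h)`, and as the pair mean of `f` beats that of `g`, the rest is at most
  -- the deviation.
  have hSf := hqf.smoothedPotential_le hh
  have h2 : 2 / (n * h n) = 1 / (n * h n) + 1 / (n * h n) := by ring
  have hKle : 16 * (1 / h n ^ 2) / Real.sqrt n * chainingConst c s D ≤
      16 * |chainingConst c s D| / (h n ^ 2 * Real.sqrt n) := by
    calc _ ≤ 16 * (1 / h n ^ 2) / Real.sqrt n * |chainingConst c s D| := by
          gcongr; exact le_abs_self _
      _ = _ := by field_simp
  rw [h2] at hle
  unfold pairDeviation
  linarith [hEf.1, hEf.2, hEg.1, hEg.2]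

theorem tendsto_sampleLaw_excess [MetricSpace 𝒳] [MeasurableSpace 𝒳] [BorelSpace 𝒳]
    {ρ : Measure (𝒳 × ℝ)} [IsProbabilityMeasure ρ]
    (hsep : ∃ S : Set 𝒳, TopologicalSpace.IsSeparable S ∧ ∀ᵐ x ∂ρ.fst, x ∈ S)
    {fstar : 𝒳 → ℝ} {p : 𝒳 → ℝ → ℝ} (hmodel : IsAdmissibleModel ρ fstar p)
    {H : Set (𝒳 → ℝ)} (hH : IsAdmissibleSpace ρ fstar H) {h : ℕ → ℝ}
    {fz : (n : ℕ) → (Fin n → 𝒳 × ℝ) → 𝒳 → ℝ} (hpos : ∀ n : ℕ, 0 < n → 0 < h n)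
    (hlim : Tendsto h atTop (𝓝 0))
    (hrate : Tendsto (fun n : ℕ => h n ^ 2 * Real.sqrt (n : ℝ)) atTop atTop)
    (hfz : IsEmpiricalMEE ρ H h fz) {ε : ℝ} (hε : 0 < ε) :
    Tendsto (fun n : ℕ => sampleLaw ρ n
      {z | ε < renyiEntropy ρ (fz n z) - minRenyiEntropy ρ}) atTop (𝓝 0) := by
  have hm := hmodel.toIsRegressionModel
  obtain ⟨Mp, hMp⟩ := hmodel.density_bounded
  obtain ⟨g, hgH, hg⟩ := hH.minimizer_mem
  obtain ⟨v, K, hv, hK, hcore⟩ := exists_sampleLaw_excess_le hsep hm hMp hH hgH hg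
  have hbias := (isBoundedDensity_mixtureDensity hm hMp hg.1).tendsto_smoothedPotential hpos hlim
  set b : ℕ → ℝ := fun n => (∫ e, mixtureDensity ρ fstar p g e ^ 2) -
    smoothedPotential (h n) (mixtureDensity ρ fstar p g) with hb
  -- Half of the budget `v ε` goes to concentration, with `τ` fixed; the sampling, diagonal and bias
  -- terms vanish and eventually fit into the other half.
  set τ := v * ε / 2 with hτ
  have hτ0 : 0 < τ := by positivity
  have hsmall : Tendsto (fun n : ℕ => (K + 2) / (h n ^ 2 * Real.sqrt n) + b n) atTop (𝓝 0) := by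
    simpa using (hrate.const_div_atTop (K + 2)).add hbias
  have hev : ∀ᶠ n : ℕ in atTop, sampleLaw ρ n
      {z | ε < renyiEntropy ρ (fz n z) - minRenyiEntropy ρ} ≤
        ENNReal.ofReal (Real.exp (-(τ ^ 2 / 32 * (h n ^ 2 * Real.sqrt n)))) := by
    filter_upwards [hsmall.eventually_lt_const hτ0, hlim.eventually_lt_const one_pos,
      eventually_gt_atTop 0] with n hn1 hn2 hn
    have hhn := hpos n hn
    have hn' : (1 : ℝ) ≤ n := by exact_mod_cast hn
    have hsq : 1 ≤ Real.sqrt n := Real.one_le_sqrt.2 hn'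
    have hss : Real.sqrt n * Real.sqrt n = n := Real.mul_self_sqrt (by positivity)
    have hdiag : 2 / (n * h n) ≤ 2 / (h n ^ 2 * Real.sqrt n) := by
      refine div_le_div_of_nonneg_left (by norm_num) (by positivity) ?_
      calc h n ^ 2 * Real.sqrt n = h n * Real.sqrt n * h n := by ring
        _ ≤ h n * Real.sqrt n * Real.sqrt n := by
            gcongr
            exact hn2.le.trans hsq
        _ = n * h n := by rw [mul_assoc, hss, mul_comm]
    refine (hcore h fz hfz n hn hhn ε τ (b n) hε.le hτ0.le le_rfl ?_).trans ?_
    · have : (K + 2) / (h n ^ 2 * Real.sqrt n) =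
          K / (h n ^ 2 * Real.sqrt n) + 2 / (h n ^ 2 * Real.sqrt n) := add_div _ _ _
      linarith
    · refine ENNReal.ofReal_le_ofReal (Real.exp_le_exp.2 ?_)
      have h4 : h n ^ 2 * Real.sqrt n ≤ n * h n ^ 2 := by
        rw [mul_comm]
        refine mul_le_mul_of_nonneg_right ?_ (by positivity)
        nlinarith
      have h5 := mul_le_mul_of_nonneg_left h4 (show 0 ≤ τ ^ 2 / 32 by positivity)
      linarith
  have hzero : Tendsto (fun n : ℕ => ENNReal.ofReal
      (Real.exp (-(τ ^ 2 / 32 * (h n ^ 2 * Real.sqrt n))))) atTop (𝓝 0) := by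
    have h1 := Real.tendsto_exp_neg_atTop_nhds_zero.comp
      (hrate.const_mul_atTop (show 0 < τ ^ 2 / 32 by positivity))
    simpa using ENNReal.tendsto_ofReal h1
  exact tendsto_of_tendsto_of_tendsto_of_le_of_le' tendsto_const_nhds hzero
    (Eventually.of_forall fun _ => zero_le) hev

/-- With `r = n^(-1/6)`, the bias `h` and the sampling error `1/(h²√n)` are both of order `r`, while
the diagonal term is of smaller order. -/
theorem exists_sampleLaw_rate_le [MetricSpace 𝒳] [MeasurableSpace 𝒳] [BorelSpace 𝒳]
    {ρ : Measure (𝒳 × ℝ)} [IsProbabilityMeasure ρ]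
    (hsep : ∃ S : Set 𝒳, TopologicalSpace.IsSeparable S ∧ ∀ᵐ x ∂ρ.fst, x ∈ S)
    {fstar : 𝒳 → ℝ} {p : 𝒳 → ℝ → ℝ} (hmodel : IsAdmissibleModel ρ fstar p)
    {H : Set (𝒳 → ℝ)} (hH : IsAdmissibleSpace ρ fstar H) {M' : ℝ}
    (hM' : ∀ x t, DifferentiableAt ℝ (p x) t ∧ |deriv (p x) t| ≤ M')
    {C₁ C₂ : ℝ} (hC₁ : 0 < C₁) (hC₂ : C₁ ≤ C₂) :
    ∃ C : ℝ, 0 < C ∧ ∀ (h : ℕ → ℝ) (fz : (n : ℕ) → (Fin n → 𝒳 × ℝ) → 𝒳 → ℝ),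
      (∀ n : ℕ, 0 < n → C₁ * (n : ℝ) ^ (-(1 / 6) : ℝ) ≤ h n ∧
        h n ≤ C₂ * (n : ℝ) ^ (-(1 / 6) : ℝ)) →
      IsEmpiricalMEE ρ H h fz →
      ∀ n : ℕ, 0 < n → ∀ δ : ℝ, 0 < δ → δ < 1 →
        sampleLaw ρ n
          {z | C * Real.sqrt (Real.log (2 / δ)) * (n : ℝ) ^ (-(1 / 6) : ℝ) <
            renyiEntropy ρ (fz n z) - minRenyiEntropy ρ}
          ≤ ENNReal.ofReal δ := by
  have hm := hmodel.toIsRegressionModel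
  obtain ⟨Mp, hMp⟩ := hmodel.density_bounded
  obtain ⟨g, hgH, hg⟩ := hH.minimizer_mem
  obtain ⟨v, K, hv, hK, hcore⟩ := exists_sampleLaw_excess_le hsep hm hMp hH hgH hg
  have hC₂0 : 0 < C₂ := hC₁.trans_le hC₂
  have hlog2 : 0 < Real.log 2 := Real.log_pos (by norm_num)
  set l₀ := Real.sqrt (Real.log 2) with hl₀
  have hl₀0 : 0 < l₀ := Real.sqrt_pos.2 hlog2
  set A := K / C₁ ^ 2 + 2 / C₁ + |M'| * C₂ with hA
  have hA0 : 0 ≤ A := by positivity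
  -- `A` collects the deterministic terms; since `log (2/δ) ≥ log 2`, dividing by `l₀` lets them be
  -- absorbed into a multiple of `√(log (2/δ))`. The `6 / C₁` pays for `τ`.
  refine ⟨(A / l₀ + 6 / C₁) / v, by positivity, ?_⟩
  intro h fz hh hfz n hn δ hδ hδ1
  obtain ⟨hlo, hhi⟩ := hh n hn
  have hn' : (1 : ℝ) ≤ n := by exact_mod_cast hn
  have hn0 : (0 : ℝ) < n := by linarith
  set r := (n : ℝ) ^ (-(1 / 6) : ℝ) with hr
  have hr0 : 0 < r := Real.rpow_pos_of_pos hn0 _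
  have hr1 : r ≤ 1 := Real.rpow_le_one_of_one_le_of_nonpos hn' (by norm_num)
  have hhn : 0 < h n := lt_of_lt_of_le (by positivity) hlo
  have hnr : (n : ℝ) * r ^ 6 = 1 := by
    rw [hr, ← Real.rpow_natCast, ← Real.rpow_mul hn0.le]
    norm_num
    rw [Real.rpow_neg_one, mul_inv_cancel₀ hn0.ne']
  have hsr : Real.sqrt n * r ^ 3 = 1 := by
    have : (Real.sqrt n * r ^ 3) ^ 2 = 1 := by
      rw [mul_pow, Real.sq_sqrt hn0.le, ← pow_mul, hnr]
    exact (pow_eq_one_iff_of_nonneg (by positivity) two_ne_zero).1 this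
  set l := Real.sqrt (Real.log (2 / δ)) with hl
  have hlog : Real.log 2 ≤ Real.log (2 / δ) := by
    refine Real.log_le_log (by norm_num) ?_
    rw [le_div_iff₀ hδ]; linarith
  have hl0 : 0 ≤ l := Real.sqrt_nonneg _
  have hll : l₀ ≤ l := Real.sqrt_le_sqrt hlog
  have hlsq : l ^ 2 = Real.log (2 / δ) := Real.sq_sqrt (hlog2.le.trans hlog)
  have hbias : (∫ e, mixtureDensity ρ fstar p g e ^ 2) -
      smoothedPotential (h n) (mixtureDensity ρ fstar p g) ≤ |M'| * C₂ * r := by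
    refine ((isBoundedDensity_mixtureDensity hm hMp
      hg.1).integral_sq_sub_smoothedPotential_le_of_lipschitz
      (abs_mixtureDensity_sub_le hm hMp hM' hg.1) hhn).trans ?_
    calc M' * h n ≤ |M'| * h n := mul_le_mul_of_nonneg_right (le_abs_self _) hhn.le
      _ ≤ |M'| * (C₂ * r) := by gcongr
      _ = _ := by ring
  have hsample : K / (h n ^ 2 * Real.sqrt n) ≤ K / C₁ ^ 2 * r := by
    rw [div_mul_eq_mul_div, div_le_div_iff₀ (by positivity) (by positivity)]
    have h1 : C₁ ^ 2 ≤ r * (h n ^ 2 * Real.sqrt n) := by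
      calc C₁ ^ 2 = r * ((C₁ * r) ^ 2 * Real.sqrt n) := by
            linear_combination (-C₁ ^ 2) * hsr
        _ ≤ _ := by gcongr
    calc K * C₁ ^ 2 ≤ K * (r * (h n ^ 2 * Real.sqrt n)) := by gcongr
      _ = _ := by ring
  have hdiag : 2 / (n * h n) ≤ 2 / C₁ * r := by
    rw [div_mul_eq_mul_div, div_le_div_iff₀ (by positivity) (by positivity)]
    have h1 : C₁ ≤ r * (n * h n) := by
      calc C₁ = C₁ * (n * r ^ 6) := by rw [hnr, mul_one]
        _ ≤ C₁ * (n * r ^ 2) := by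
            gcongr C₁ * (n * ?_)
            exact pow_le_pow_of_le_one hr0.le hr1 (by norm_num)
        _ = r * (n * (C₁ * r)) := by ring
        _ ≤ _ := by gcongr
    linarith
  -- `6² ≥ 32` makes the exponent at least `log (2/δ)`. Concentration alone would allow order `l
  -- r²`; the cruder `l r` matches the other terms and suffices since `r ≤ 1`.
  set τ := 6 * l * r / C₁ with hτ
  refine (hcore h fz hfz n hn hhn _ τ _ (by positivity) (by positivity) hbias ?_).trans ?_
  · have h1 : A ≤ A / l₀ * l := by
      rw [div_mul_eq_mul_div, le_div_iff₀ hl₀0]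
      gcongr
    have h2 : v * ((A / l₀ + 6 / C₁) / v * l * r) = A / l₀ * l * r + τ := by
      rw [hτ]; field_simp
    rw [h2]
    have h3 : A * r ≤ A / l₀ * l * r := by gcongr
    have h4 : A * r = K / C₁ ^ 2 * r + 2 / C₁ * r + |M'| * C₂ * r := by rw [hA]; ring
    linarith
  · refine ENNReal.ofReal_le_ofReal ?_
    have h1 : l ^ 2 ≤ τ ^ 2 * (n * h n ^ 2) / 32 := by
      have h2 : l ^ 2 * 36 ≤ τ ^ 2 * (n * h n ^ 2) := by
        calc l ^ 2 * 36 = l ^ 2 * 36 * (n * r ^ 6) := by rw [hnr, mul_one]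
          _ ≤ l ^ 2 * 36 * (n * r ^ 4) := by
              gcongr l ^ 2 * 36 * (n * ?_)
              exact pow_le_pow_of_le_one hr0.le hr1 (by norm_num)
          _ = τ ^ 2 * (n * (C₁ * r) ^ 2) := by rw [hτ]; field_simp; norm_num
          _ ≤ _ := by gcongr
      nlinarith [sq_nonneg l]
    calc Real.exp (-(τ ^ 2 * (n * h n ^ 2)) / 32) ≤ Real.exp (-Real.log (2 / δ)) := by
          rw [Real.exp_le_exp, ← hlsq]; linarith
      _ = δ / 2 := by rw [Real.exp_neg, Real.exp_log (by positivity), inv_div]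
      _ ≤ δ := by linarith

end MEE

theorem mainTheorem1 {𝒳 : Type*} [MetricSpace 𝒳] [MeasurableSpace 𝒳] [BorelSpace 𝒳]
    (ρ : Measure (𝒳 × ℝ)) [IsProbabilityMeasure ρ]
    (hsep : ∃ S : Set 𝒳, TopologicalSpace.IsSeparable S ∧ ∀ᵐ x ∂ρ.fst, x ∈ S)
    (fstar : 𝒳 → ℝ) (p : 𝒳 → ℝ → ℝ) (hmodel : MEE.IsAdmissibleModel ρ fstar p)
    (H : Set (𝒳 → ℝ)) (hH : MEE.IsAdmissibleSpace ρ fstar H) :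
    (∀ (h : ℕ → ℝ) (fz : (n : ℕ) → (Fin n → 𝒳 × ℝ) → 𝒳 → ℝ),
      (∀ n : ℕ, 0 < n → 0 < h n) →
      Tendsto h atTop (𝓝 0) →
      Tendsto (fun n : ℕ => h n ^ 2 * Real.sqrt (n : ℝ)) atTop atTop →
      MEE.IsEmpiricalMEE ρ H h fz →
      ∀ ε : ℝ, 0 < ε →
        Tendsto (fun n : ℕ => MEE.sampleLaw ρ n
          {z | ε < MEE.renyiEntropy ρ (fz n z) - MEE.minRenyiEntropy ρ}) atTop (𝓝 0)) ∧
    ((∃ M' : ℝ, ∀ x t, DifferentiableAt ℝ (p x) t ∧ |deriv (p x) t| ≤ M') →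
      ∀ C₁ C₂ : ℝ, 0 < C₁ → C₁ ≤ C₂ →
      ∃ C : ℝ, 0 < C ∧
        ∀ (h : ℕ → ℝ) (fz : (n : ℕ) → (Fin n → 𝒳 × ℝ) → 𝒳 → ℝ),
          (∀ n : ℕ, 0 < n → C₁ * (n : ℝ) ^ (-(1 / 6) : ℝ) ≤ h n ∧
            h n ≤ C₂ * (n : ℝ) ^ (-(1 / 6) : ℝ)) →
          MEE.IsEmpiricalMEE ρ H h fz →
          ∀ n : ℕ, 0 < n → ∀ δ : ℝ, 0 < δ → δ < 1 →
            MEE.sampleLaw ρ n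
              {z | C * Real.sqrt (Real.log (2 / δ)) * (n : ℝ) ^ (-(1 / 6) : ℝ) <
                MEE.renyiEntropy ρ (fz n z) - MEE.minRenyiEntropy ρ}
              ≤ ENNReal.ofReal δ) :=
  ⟨fun _ _ hpos hlim hrate hfz _ hε =>
      MEE.tendsto_sampleLaw_excess hsep hmodel hH hpos hlim hrate hfz hε,
    fun ⟨_, hM'⟩ _ _ hC₁ hC₂ => MEE.exists_sampleLaw_rate_le hsep hmodel hH hM' hC₁ hC₂⟩
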